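/- **Theorem 1.3.** All groups are finite, and $M=\{1,\dots,m\}$ for a positive integer $m$. For partitions (families of sets) $\mathcal P,\mathcal Q$ of the same set, $\mathcal P\ge\mathcal Q$ means that both are partitions and that every class of $\mathcal Q$ is a union of classes of $\mathcal P$. *S-rings.* For $X\subseteq G$ let $\underline X\in\mathbb Z G$ be the sum of the elements of $X$. An S-ring over $G$ is a subring $\mathfrak A=\mathrm{Span}_{\mathbb Z}\{\underline X: X\in\mathcal S\}$ of $\mathbb ZG$, where $\mathcal S=\mathcal S(\mathfrak A)$ is a partition of $G$ that has $\{1_G\}$ as a class and is closed under $X\mapsto X^{-1}$; the classes of $\mathcal S$ are called basic sets. An algebraic isomorphism $\varphi:\mathfrak A\to\mathfrak A'$ of S-rings over groups $H$ and $H'$ is a ring isomorphism that takes each $\underline X$, $X\in\mathcal S(\mathfrak A)$, to some $\underline{X'}$, $X'\in\mathcal S(\mathfrak A')$. It is induced by an isomorphism if there is a bijection $f:H\to H'$ with $f(1)=1$ such that $\varphi(\underline X)=\underline{f(X)}$ for all $X\in\mathcal S(\mathfrak A)$ and such that for each $X\in\mathcal S(\mathfrak A)$ there is $X'\in\mathcal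 S(\mathfrak A')$ with $xy^{-1}\in X\Leftrightarrow f(x)f(y)^{-1}\in X'$ for all $x,y\in H$. Let $\mathfrak A_m(G)$ be the smallest S-ring over $G^m$ that contains $\underline{\{(g,\dots,g):g\in G\}}$ and all the elements $\underline{\{x\in G^m:\ x_i=1_G\Leftrightarrow i\in I\}}$, $I\subseteq M$ (the latter span the $m$th tensor power of the trivial S-ring over $G$). *The Weisfeiler-Leman partition.* For $\sigma:M\to M$ put $x^\sigma=(x_{\sigma(1)},\dots,x_{\sigma(m)})$. An $m$-ary rainbow on a finite set $\Omega$ is a partition $\mathfrak X$ of $\Omega^m$ such that, for every $X\in\mathfrak X$, the relation $x_i=x_j$ on $M$ is the same for all $x\in X$, and $X^\sigma\in\mathfrak X$ for all maps $\sigma:M\to M$. It is an $m$-ary coherent configuration if, for all $X_0,\dots,X_m\in\mathfrak X$, the number $n^{X_0}_{X_1,\dots,X_m}$ of those $\alpha\in\Omega$ for which $(x_1,\dots,x_{i-1},\alpha,x_{i+1},\dots,x_m)\in X_i$ for all $i\in M$ does not depend on $x\in X_0$. For $x\in G^m$ let $\mu(x)=\{(i,j,k)\in M^3:x_ix_j=x_k\}$.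 Let $\mathfrak X_m(G)$ be the smallest (coarsest) $m$-ary rainbow on $G$ such that $\mu$ is constant on each of its classes, and let $\mathrm{WL}_m(G)$ be the smallest (coarsest) $m$-ary coherent configuration on $G$ with $\mathrm{WL}_m(G)\ge\mathfrak X_m(G)$. Groups $G$ and $G'$ are $\mathrm{WL}_m$-equivalent if there is a bijection $\varphi:\mathrm{WL}_m(G)\to\mathrm{WL}_m(G')$ such that $\varphi(X^\sigma)=\varphi(X)^\sigma$, $n^{X_0}_{X_1,\dots,X_m}=n^{\varphi(X_0)}_{\varphi(X_1),\dots,\varphi(X_m)}$ and $\mu(X)=\mu(\varphi(X))$ for all classes $X,X_0,\dots,X_m$ and all $\sigma:M\to M$. Let $\dim_{\mathrm{WL}}(G)$ be the smallest integer $m\ge2$ such that every group $\mathrm{WL}_m$-equivalent to $G$ is isomorphic to $G$. For $n\ge m$ and a partition $\mathcal P$ of $G^n$, let $\mathcal P_{G^m}$ be the family of the projections of the classes of $\mathcal P$ to the first $m$ coordinates. **Statement.** Let $G$ be a finite group. Then for every positive integer $m$, $$\mathrm{WL}_{3m}(G)_{G^m}\ \ge\ \mathcal S(\mathfrak A_m(G))\qquad\text{and}\qquad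 \mathcal S(\mathfrak A_{m+1}(G))_{G^m}\ \ge\ \mathrm{WL}_m(G).$$ Moreover, there is an integer $s\ge3$ such that for every $m\ge s$ each algebraic isomorphism from $\mathfrak A_m(G)$ to an S-ring over a finite group is induced by an isomorphism; and if $s(G)$ denotes the least such $s$, then $$\dim_{\mathrm{WL}}(G)\le 3\,s(G)\qquad\text{and}\qquad s(G)\le\dim_{\mathrm{WL}}(G)+1.$$ -/

import Mathlib

open scoped Pointwise

namespace WLSchur

universe u v

/-! Partitions of a set `α` are represented by `Setoid α`; the classes of `r` are the members of
`r.classes`. In Mathlib's order on `Setoid α`, `r ≤ s` means that `r` is finer than `s`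
(the opposite of the order on partitions used for S-rings and rainbows, in which finer partitions
are larger). Hence the smallest S-ring or coherent configuration with a given property is the
supremum in `Setoid α` of all the partitions having this property. -/

section Partitions

/-- The partition `P` is at least as fine as the partition `Q` (written `P ≥ Q`): both families of
sets are partitions and every class of `Q` is a union of classes of `P`. -/
def IsAtLeastAsFine {α : Type u} (P Q : Set (Set α)) : Prop :=
  Setoid.IsPartition P ∧ Setoid.IsPartition Q ∧ ∀ Y ∈ Q, ∃ T ⊆ P, Y = ⋃₀ T

/-- The projection `Ω ^ n → Ω ^ m` onto the first `m` coordinates. -/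
def prFirst {Ω : Type u} {m n : ℕ} (h : m ≤ n) (x : Fin n → Ω) : Fin m → Ω :=
  fun i => x (Fin.castLE h i)

/-- The family of the projections to `Ω ^ m` of the classes of a partition of `Ω ^ n`. -/
def projClasses {Ω : Type u} {m n : ℕ} (h : m ≤ n) (r : Setoid (Fin n → Ω)) :
    Set (Set (Fin m → Ω)) :=
  {Y | ∃ X ∈ r.classes, Y = prFirst h '' X}

end Partitions

section SchurRings

variable {G : Type u} [Group G] [Finite G]

/-- The element of the group ring `ℤG` that is the sum of the elements of `X ⊆ G`. -/
noncomputable def setSum (X : Set G) : MonoidAlgebra ℤ G :=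
  ∑ x ∈ X.toFinite.toFinset, MonoidAlgebra.single x (1 : ℤ)

/-- The `ℤ`-submodule of `ℤG` spanned by the sums of the classes of a partition of `G`. -/
noncomputable def classSpan (r : Setoid G) : Submodule ℤ (MonoidAlgebra ℤ G) :=
  Submodule.span ℤ (setSum '' r.classes)

/-- The conditions on a partition of `G` to be the partition into the basic sets of an S-ring. -/
structure IsSchurPartition (r : Setoid G) : Prop where
  one_mem : {1} ∈ r.classes
  inv_mem : ∀ X ∈ r.classes, X⁻¹ ∈ r.classes
  mul_mem : ∀ X ∈ r.classes, ∀ Y ∈ r.classes, setSum X * setSum Y ∈ classSpan r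

lemma setSum_coeff (X : Set G) (g : G) [Decidable (g ∈ X)] :
    (setSum X).coeff g = if g ∈ X then 1 else 0 := by
  classical
  simp [setSum, MonoidAlgebra.coeff_sum, Finsupp.single_apply]

/-- The module `classSpan r` consists of the elements of `ℤG` whose coefficients are constant on
the classes of `r`. -/
lemma mem_classSpan {r : Setoid G} {a : MonoidAlgebra ℤ G} :
    a ∈ classSpan r ↔ ∀ x y, r x y → a.coeff x = a.coeff y := by
  classical
  constructor
  · intro h
    induction h using Submodule.span_induction with
    | mem a ha =>
      obtain ⟨X, hX, rfl⟩ := ha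
      intro x y hxy
      obtain ⟨z, rfl⟩ := hX
      have : r x z ↔ r y z := ⟨fun h => r.trans (r.symm hxy) h, fun h => r.trans hxy h⟩
      simp [setSum_coeff, this]
    | zero => intro x y _; simp
    | add a b _ _ iha ihb =>
      intro x y hxy
      simp [iha x y hxy, ihb x y hxy]
    | smul c a _ iha =>
      intro x y hxy
      rw [MonoidAlgebra.coeff_smul, Finsupp.smul_apply, Finsupp.smul_apply, iha x y hxy]
  · intro h
    have : Fintype (Quotient r) := Fintype.ofFinite _
    have key : a = ∑ q : Quotient r, a.coeff q.out • setSum {x | r x q.out} := by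
      ext g
      have hq : ∀ q : Quotient r, r g q.out ↔ Quotient.mk r g = q := fun q => by
        conv_rhs => rw [← Quotient.out_eq q]
        exact Quotient.eq.symm
      have hg : a.coeff g = a.coeff (Quotient.mk r g).out := h _ _ ((hq _).2 rfl)
      simp only [MonoidAlgebra.coeff_sum, MonoidAlgebra.coeff_smul, Finsupp.finsetSum_apply,
        Finsupp.smul_apply, setSum_coeff, Set.mem_ofPred_eq, hq]
      simp [← hg]
    rw [key]
    exact Submodule.sum_mem _ fun q _ => Submodule.smul_mem _ _
      (Submodule.subset_span (Set.mem_image_of_mem setSum (r.mem_classes q.out)))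

lemma one_eq_setSum : (1 : MonoidAlgebra ℤ G) = setSum {1} := by
  classical
  ext g
  rw [setSum_coeff, MonoidAlgebra.one_def]
  simp [Finsupp.single_apply, eq_comm]

lemma IsSchurPartition.mul_mem_classSpan {r : Setoid G} (hr : IsSchurPartition r)
    {a b : MonoidAlgebra ℤ G} (ha : a ∈ classSpan r) (hb : b ∈ classSpan r) :
    a * b ∈ classSpan r := by
  have h : classSpan r * classSpan r ≤ classSpan r := by
    unfold classSpan
    rw [Submodule.span_mul_span, Submodule.span_le]
    rintro _ ⟨_, ⟨X, hX, rfl⟩, _, ⟨Y, hY, rfl⟩, rfl⟩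
    exact hr.mul_mem X hX Y hY
  exact h (Submodule.mul_mem_mul ha hb)

lemma IsSchurPartition.rel_one {r : Setoid G} (hr : IsSchurPartition r) {x y : G}
    (h : r x y) : x = 1 ↔ y = 1 := by
  obtain ⟨z, hz⟩ := hr.one_mem
  have h1 : ∀ w, w = 1 ↔ r w z := fun w => by
    rw [← Set.mem_singleton_iff, hz]; rfl
  rw [h1, h1]
  exact ⟨fun h' => r.trans (r.symm h) h', fun h' => r.trans h h'⟩

lemma IsSchurPartition.rel_inv {r : Setoid G} (hr : IsSchurPartition r) {x y : G}
    (h : r x y) : r x⁻¹ y⁻¹ := by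
  obtain ⟨z, hz⟩ := hr.inv_mem _ (r.mem_classes y)
  have h1 : ∀ w, r w⁻¹ y ↔ r w z := fun w => Set.ext_iff.1 hz w
  have hx : r x⁻¹ z := (h1 _).1 (by simpa using h)
  have hy : r y⁻¹ z := (h1 _).1 (by simp)
  exact r.trans hx (r.symm hy)

lemma mem_classSpan_sSup {S : Set (Setoid G)} {a : MonoidAlgebra ℤ G} :
    a ∈ classSpan (sSup S) ↔ ∀ r ∈ S, a ∈ classSpan r := by
  simp only [mem_classSpan]
  constructor
  · exact fun h r hr x y hxy => h x y (le_sSup hr hxy)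
  · intro h x y hxy
    have hle : sSup S ≤ Setoid.ker a.coeff := sSup_le fun r hr x y hxy => h r hr x y hxy
    exact hle hxy

/-- The intersection of S-rings is an S-ring. -/
lemma isSchurPartition_sSup {S : Set (Setoid G)} (hS : ∀ r ∈ S, IsSchurPartition r) :
    IsSchurPartition (sSup S) := by
  have inv : ∀ {x y}, sSup S x y → sSup S x⁻¹ y⁻¹ := by
    intro x y hxy
    have hle : sSup S ≤ Setoid.comap (fun g : G => g⁻¹) (sSup S) :=
      sSup_le fun r hr x y hxy => le_sSup hr ((hS r hr).rel_inv hxy)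
    exact hle hxy
  refine ⟨⟨1, ?_⟩, ?_, ?_⟩
  · have hle : sSup S ≤ Setoid.ker (fun g : G => g = 1) :=
      sSup_le fun r hr x y hxy => propext ((hS r hr).rel_one hxy)
    ext x
    refine ⟨fun h => ?_, fun h => ?_⟩
    · rw [Set.mem_singleton_iff.1 h]
      exact (sSup S).refl 1
    · have h2 : (x = 1) = ((1 : G) = 1) := hle h
      exact h2.mpr rfl
  · rintro _ ⟨y, rfl⟩
    refine ⟨y⁻¹, Set.ext fun x => ⟨fun h => ?_, fun h => ?_⟩⟩
    · simpa using inv h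
    · simpa using inv h
  · intro X hX Y hY
    rw [mem_classSpan_sSup]
    intro r hr
    have hle : ∀ Z ∈ (sSup S).classes, setSum Z ∈ classSpan r := fun Z hZ =>
      mem_classSpan_sSup.1 (Submodule.subset_span (Set.mem_image_of_mem setSum hZ)) r hr
    exact (hS r hr).mul_mem_classSpan (hle X hX) (hle Y hY)

variable (G) in
/-- A Schur ring over `G`, given by the (uniquely determined) partition of `G` into its basic sets;
the ring itself is `SchurRing.toSubring`. -/
structure SchurRing where
  rel : Setoid G
  isSchurPartition : IsSchurPartition rel

namespace SchurRing

/-- The partition of `G` into the basic sets of a Schur ring over `G`. -/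
def basicSets (A : SchurRing G) : Set (Set G) := A.rel.classes

/-- The Schur ring as a subring of the group ring `ℤG`: the `ℤ`-span of the elements that are the
sums of the basic sets. -/
noncomputable def toSubring (A : SchurRing G) : Subring (MonoidAlgebra ℤ G) where
  carrier := classSpan A.rel
  mul_mem' ha hb := A.isSchurPartition.mul_mem_classSpan ha hb
  one_mem' := by
    rw [one_eq_setSum]
    exact Submodule.subset_span (Set.mem_image_of_mem setSum A.isSchurPartition.one_mem)
  add_mem' ha hb := Submodule.add_mem _ ha hb
  zero_mem' := Submodule.zero_mem _
  neg_mem' ha := Submodule.neg_mem _ ha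

lemma setSum_mem (A : SchurRing G) {X : Set G} (hX : X ∈ A.basicSets) :
    setSum X ∈ A.toSubring :=
  Submodule.subset_span (Set.mem_image_of_mem setSum hX)

/-- The element of a Schur ring that is the sum of the elements of a basic set. -/
noncomputable def basicElt (A : SchurRing G) (X : A.basicSets) : A.toSubring :=
  ⟨setSum (X : Set G), A.setSum_mem X.2⟩

/-- The smallest Schur ring over `G` that contains a given set of elements of `ℤG`. -/
noncomputable def closure (s : Set (MonoidAlgebra ℤ G)) : SchurRing G where
  rel := sSup {r | IsSchurPartition r ∧ s ⊆ classSpan r}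
  isSchurPartition := isSchurPartition_sSup fun _ hr => hr.1

lemma subset_closure (s : Set (MonoidAlgebra ℤ G)) : s ⊆ (closure s).toSubring :=
  fun _ ha => mem_classSpan_sSup.2 fun _ hr => hr.2 ha

lemma closure_le {s : Set (MonoidAlgebra ℤ G)} {A : SchurRing G} (h : s ⊆ A.toSubring) :
    (closure s).toSubring ≤ A.toSubring :=
  fun _ ha => mem_classSpan_sSup.1 ha A.rel ⟨A.isSchurPartition, h⟩

variable {H : Type v} [Group H] [Finite H]

/-- A ring isomorphism between Schur rings is an algebraic isomorphism if it takes (the sum of)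
each basic set to (the sum of) a basic set. -/
def IsAlgebraicIso {A : SchurRing G} {B : SchurRing H} (φ : A.toSubring ≃+* B.toSubring) : Prop :=
  ∀ X : A.basicSets, ∃ Y : B.basicSets, φ (A.basicElt X) = B.basicElt Y

/-- A bijection `f : G → H` is a (combinatorial) isomorphism between Schur rings over `G` and `H`
if for each basic set `X` of the first one there is a basic set `Y` of the second one such that
`f` is an isomorphism of the Cayley graphs `Cay(G, X)` and `Cay(H, Y)`, where in `Cay(G, X)` the
vertices `x` and `y` are adjacent if and only if `x * y⁻¹ ∈ X`. -/
def IsIso (A : SchurRing G) (B : SchurRing H) (f : G ≃ H) : Prop :=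
  ∀ X ∈ A.basicSets, ∃ Y ∈ B.basicSets, ∀ x y : G, x * y⁻¹ ∈ X ↔ f x * (f y)⁻¹ ∈ Y

/-- An algebraic isomorphism `φ` is induced by an isomorphism if there is a normalized isomorphism
`f` such that `φ` takes (the sum of) each basic set `X` to (the sum of) `f(X)`. -/
def IsInducedByIso {A : SchurRing G} {B : SchurRing H} (φ : A.toSubring ≃+* B.toSubring) : Prop :=
  ∃ f : G ≃ H, IsIso A B f ∧ f 1 = 1 ∧
    ∀ X : A.basicSets, (φ (A.basicElt X) : MonoidAlgebra ℤ H) = setSum (f '' (X : Set G))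

end SchurRing

variable (G) in
/-- The `m`th tensor power `𝒯_m(G)` of the trivial S-ring over `G`: the basic sets are the nonempty
sets of the form `{x ∈ G ^ m : x_i = 1 if and only if i ∈ I}`, where `I ⊆ {1, …, m}`. -/
noncomputable def tensorPowerTrivial (m : ℕ) : Submodule ℤ (MonoidAlgebra ℤ (Fin m → G)) :=
  Submodule.span ℤ (Set.range fun I : Set (Fin m) => setSum {x : Fin m → G | ∀ i, x i = 1 ↔ i ∈ I})

variable (G) in
/-- The diagonal of `G ^ m`. -/
def diag (m : ℕ) : Set (Fin m → G) := {x | ∃ g : G, ∀ i, x i = g}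

variable (G) in
/-- The S-ring `𝔄_m(G) = 𝒯_m(G)[diag(G ^ m)]` over `G ^ m`. -/
noncomputable def schurRingPower (m : ℕ) : SchurRing (Fin m → G) :=
  SchurRing.closure ((tensorPowerTrivial G m : Set (MonoidAlgebra ℤ (Fin m → G))) ∪
    {setSum (diag G m)})

variable (G) in
/-- Every algebraic isomorphism from the S-ring `𝔄_m(G)` to an S-ring over a finite group is induced
by an isomorphism. -/
def AlgIsosInduced (m : ℕ) : Prop :=
  ∀ (H : Type u) [Group H] [Finite H] (B : SchurRing H)
    (φ : (schurRingPower G m).toSubring ≃+* B.toSubring),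
    SchurRing.IsAlgebraicIso φ → SchurRing.IsInducedByIso φ

end SchurRings

section WeisfeilerLeman

variable {Ω : Type u} {m : ℕ}

/-- A partition of `Ω ^ m` is an `m`-ary rainbow on `Ω`. Here `x ^ σ = x ∘ σ`. -/
structure IsRainbow (r : Setoid (Fin m → Ω)) : Prop where
  eq_iff : ∀ X ∈ r.classes, ∀ x ∈ X, ∀ y ∈ X, ∀ i j, x i = x j ↔ y i = y j
  comp_mem : ∀ X ∈ r.classes, ∀ σ : Fin m → Fin m, (fun x => x ∘ σ) '' X ∈ r.classes

/-- The number `n(x; X_1, …, X_m)` of all `α ∈ Ω` such that, for each `i`, replacing the `i`th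
coordinate of `x` by `α` gives an element of `X_i`. -/
noncomputable def tupleCount (x : Fin m → Ω) (X : Fin m → Set (Fin m → Ω)) : ℕ :=
  Set.ncard {α : Ω | ∀ i, Function.update x i α ∈ X i}

/-- A partition of `Ω ^ m` is an `m`-ary coherent configuration on `Ω`. -/
structure IsCoherent (r : Setoid (Fin m → Ω)) : Prop extends IsRainbow r where
  count_eq : ∀ X₀ ∈ r.classes, ∀ X : Fin m → Set (Fin m → Ω), (∀ i, X i ∈ r.classes) →
    ∀ x ∈ X₀, ∀ y ∈ X₀, tupleCount x X = tupleCount y X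

/-- The smallest `m`-ary coherent configuration that is at least as fine as a given partition
(that is, the coarsest one among those finer than or equal to it). -/
def wlClosure (r : Setoid (Fin m → Ω)) : Setoid (Fin m → Ω) :=
  sSup {s | IsCoherent s ∧ s ≤ r}

/-- The smallest (coarsest) `m`-ary rainbow on a group `G` such that the relations `x_i = x_j` and
`x_i x_j = x_k` between the coordinates do not depend on the choice of `x` in a class. -/
def initialRainbow (m : ℕ) (G : Type u) [Group G] : Setoid (Fin m → G) :=
  sSup {r | IsRainbow r ∧ ∀ X ∈ r.classes, ∀ x ∈ X, ∀ y ∈ X,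
    (∀ i j, x i = x j ↔ y i = y j) ∧ ∀ i j k, x i * x j = x k ↔ y i * y j = y k}

/-- The Weisfeiler-Leman partition `WL_m(G)` of `G ^ m`. -/
def WL (m : ℕ) (G : Type u) [Group G] : Setoid (Fin m → G) :=
  wlClosure (initialRainbow m G)

/-- Algebraic isomorphisms of `m`-ary coherent configurations. -/
structure IsAlgebraicIsoWL {Ω' : Type v} {r : Setoid (Fin m → Ω)} {r' : Setoid (Fin m → Ω')}
    (φ : r.classes ≃ r'.classes) : Prop where
  map_comp : ∀ (X Y : r.classes) (σ : Fin m → Fin m),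
    (Y : Set (Fin m → Ω)) = (fun x => x ∘ σ) '' (X : Set (Fin m → Ω)) →
      (φ Y : Set (Fin m → Ω')) = (fun x => x ∘ σ) '' (φ X : Set (Fin m → Ω'))
  map_count : ∀ (X₀ : r.classes) (X : Fin m → r.classes),
    ∀ x ∈ (X₀ : Set (Fin m → Ω)), ∀ y ∈ (φ X₀ : Set (Fin m → Ω')),
      tupleCount x (fun i => (X i : Set (Fin m → Ω))) = tupleCount y (fun i => (φ (X i) : Set (Fin m → Ω')))

/-- A bijection between the classes of partitions of `G ^ m` and `H ^ m` is genuine if it preserves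
the relation `{(i, j, k) : x_i x_j = x_k}` of the tuples `x` in a class. -/
def IsGenuine {G : Type u} [Group G] {H : Type v} [Group H] {r : Setoid (Fin m → G)}
    {r' : Setoid (Fin m → H)} (φ : r.classes ≃ r'.classes) : Prop :=
  ∀ X : r.classes, ∀ x ∈ (X : Set (Fin m → G)), ∀ y ∈ (φ X : Set (Fin m → H)),
    ∀ i j k, x i * x j = x k ↔ y i * y j = y k

/-- Two groups are `WL_m`-equivalent if there is a genuine algebraic isomorphism between their
Weisfeiler-Leman partitions. -/
def WLEquivalent (m : ℕ) (G : Type u) [Group G] (H : Type v) [Group H] : Prop :=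
  ∃ φ : (WL m G).classes ≃ (WL m H).classes, IsAlgebraicIsoWL φ ∧ IsGenuine φ

/-- The WL-dimension of a finite group `G`: the smallest `m ≥ 2` such that every finite group that
is `WL_m`-equivalent to `G` is isomorphic to `G`. -/
noncomputable def wlDim (G : Type u) [Group G] : ℕ :=
  sInf {m | 2 ≤ m ∧ ∀ (H : Type u) [Group H] [Finite H], WLEquivalent m G H → Nonempty (G ≃* H)}

end WeisfeilerLeman

end WLSchur

open WLSchur

/-!
Both families of partitions are largest bisimulations, and the theorem compares these bisimulations.

For finite groups `G` and `K`, call a relation between `G ^ m` and `K ^ m` a bisimulation for the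
Weisfeiler-Leman algorithm if it respects the atomic types of tuples, is closed under maps between
the coordinates, and has the back-and-forth property with respect to changing one coordinate
(`IsWLBisim`). The largest one, `WLRel`, is the partition `WL_m(G)` when `G = K`
(`WL_eq_wlSetoid`), and it is nonempty if and only if `G` and `K` are `WL_m`-equivalent
(`wlEquivalent_iff`). Equality of structure constants is expressed by bijections in the same way for
S-rings: a relation between two groups is a Schur bisimulation (`IsSchurBisim`) if the factorizations
of related elements can be matched. The largest one that respects the generators of `𝔄_m(G)` and
`𝔄_m(K)`, `PowerRel`, is the partition of `G ^ m` into the basic sets of `𝔄_m(G)` when `G = K`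
(`schurRingPower_rel_iff`), and algebraic isomorphisms of S-rings correspond to bitotal Schur
bisimulations (`SchurRing.IsAlgebraicIso.isSchurBisim`, `SchurRing.exists_isAlgebraicIso`).

* The `3m`-tuples `(x * y, y, x)` encode multiplication in `G ^ m`. Hence the projection of `WLRel`
  from `3m` to `m` coordinates is a Schur bisimulation (`isPowerBisim_retract`).
* In `G ^ (m + 1)` the sets given by `x_i = x_j` and by `x_i * x_j = x_k` are unions of basic sets,
  and factorizations of `(x, 1)` allow any one coordinate to be changed. Hence the projection of
  `PowerRel` from `m + 1` to `m` coordinates is a bisimulation for the Weisfeiler-Leman algorithm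
  (`isWLBisim_snocOne`).
* If `G` and `H` are `WL_{3m}`-equivalent, then there is an algebraic isomorphism from `𝔄_m(G)` to
  `𝔄_m(H)`. A bijection that induces it acts coordinatewise and, for `m ≥ 3`, by a group isomorphism
  (`AlgIsosInduced.nonempty_mulEquiv`).
* Let `φ` be an algebraic isomorphism from `𝔄_m(G)`, `m ≥ 3`, to an S-ring over a group `H`. The
  images of the subgroups `x_i = 1` and `x_i = x_j` define equivalence relations on `H` that identify
  it, as a set, with `K ^ m` for some group `K` (`IsTransfer.exists_coordinates`); the group is found
  among the permutations of one coordinate, since the bijections between pairs of coordinates which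
  the relations provide compose (`IsRatioSystem.exists_group`). The identification need not be a
  homomorphism: `H` may act on `K ^ m` with a twist by automorphisms of `K`. However, the generators
  are invariant under `K ^ m`, so the closure of `φ` under translations by `K ^ m` is still a
  bisimulation (`IsTransfer.isPowerBisim_of_coordinates`). It follows that `K` is
  `WL_{m - 1}`-equivalent to `G`. If `m - 1` is at least the Weisfeiler-Leman dimension of `G`, then
  `K` is isomorphic to `G`, and `φ` is induced by an isomorphism because `PowerRel`, the partition
  into basic sets, is the largest bisimulation (`algIsosInduced_succ`).

The dimension is finite because a tuple that lists all elements of `G` determines `G`.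
-/

namespace WLSchur

universe u v w

/-! ### Coordinatizing a family of equivalence relations by a group -/

section Coordinates

variable {Ω : Type u} {m : ℕ}

/-- Axioms satisfied by the relations `x_i y_i⁻¹ = x_j y_j⁻¹` between tuples `x`, `y` of elements
of a group, where `o` plays the role of the identity element. The relation `E i j` depends only on
the coordinates `i` and `j`, so that it amounts to a set of bijections between these coordinates. -/
structure IsRatioSystem (E : Fin m → Fin m → Setoid (Fin m → Ω)) : Prop where
  of_eq : ∀ i j u v, u i = v i → u j = v j → E i j u v
  eq_of_eq : ∀ i j u v, E i j u v → u i = v i → u j = v j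
  trans : ∀ i j k u v, E i j u v → E j k u v → E i k u v
  symm : ∀ i j u v, E i j u v → E j i u v
  of_diag : ∀ i j u v, u i = u j → v i = v j → E i j u v
  exists_rel : ∀ i j, i ≠ j → ∀ v x, ∃ w, w i = x ∧ E i j w v

namespace IsRatioSystem

variable {E : Fin m → Fin m → Setoid (Fin m → Ω)}

/-- The graph of the permutation `t`, between the coordinates `i` and `j`, lies in one class of
`E i j`. -/
def IsTranslation (E : Fin m → Fin m → Setoid (Fin m → Ω)) (i j : Fin m) (t : Equiv.Perm Ω) :
    Prop :=
  ∀ u v, u j = t (u i) → v j = t (v i) → E i j u v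

lemma IsTranslation.inv (hE : IsRatioSystem E) {i j : Fin m} {t : Equiv.Perm Ω}
    (h : IsTranslation E i j t) : IsTranslation E j i t⁻¹ := fun u v hu hv =>
  hE.symm _ _ _ _ (h u v (by simp [hu]) (by simp [hv]))

/-- A translation between the coordinates `i` and `j` is also one between `i` and `k`, since it is
the composition of a translation from `i` to `j` and the trivial one from `j` to `k`. -/
lemma IsTranslation.change_right (hE : IsRatioSystem E) {i j k : Fin m} (hij : i ≠ j) (hki : k ≠ i)
    {t : Equiv.Perm Ω} (h : IsTranslation E i j t) : IsTranslation E i k t := by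
  classical
  rcases eq_or_ne j k with rfl | hjk
  · exact h
  intro u v hu hv
  have key : ∀ u : Fin m → Ω, u k = t (u i) → E i k u (Function.update u j (u k)) := fun u _ =>
    hE.of_eq _ _ _ _ (by simp [hij]) (by simp [hjk.symm])
  refine (E i k).trans (key u hu) ((E i k).trans ?_ ((E i k).symm (key v hv)))
  refine hE.trans _ j _ _ _ (h _ _ ?_ ?_) (hE.of_diag _ _ _ _ ?_ ?_)
  · simp [hu, hij]
  · simp [hv, hij]
  · simp [hjk.symm]
  · simp [hjk.symm]

lemma IsTranslation.change_left (hE : IsRatioSystem E) {i j k : Fin m} (hij : i ≠ j) (hkj : k ≠ j)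
    {t : Equiv.Perm Ω} (h : IsTranslation E i j t) : IsTranslation E k j t := by
  have := ((h.inv hE).change_right hE hij.symm hkj).inv hE
  rwa [inv_inv] at this

/-- With at least three coordinates, a translation between two of them is one between any two. -/
lemma IsTranslation.change (hE : IsRatioSystem E) (hm : 3 ≤ m) {i j : Fin m} (hij : i ≠ j)
    {t : Equiv.Perm Ω} (h : IsTranslation E i j t) {k l : Fin m} (hkl : k ≠ l) :
    IsTranslation E k l t := by
  by_cases hkj : k = j
  · subst hkj
    obtain ⟨p, hpi, hpk⟩ : ∃ p : Fin m, p ≠ i ∧ p ≠ k := by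
      have : ({i, k} : Finset (Fin m)).card < (Finset.univ : Finset (Fin m)).card := by
        have := Finset.card_le_two (a := i) (b := k)
        simp only [Finset.card_univ, Fintype.card_fin]
        omega
      obtain ⟨p, -, hp⟩ := Finset.exists_mem_notMem_of_card_lt_card this
      simp only [Finset.mem_insert, Finset.mem_singleton, not_or] at hp
      exact ⟨p, hp⟩
    have h1 := h.change_right hE hij hpi
    have h2 := h1.change_left hE hpi.symm hpk.symm
    exact h2.change_right hE hpk.symm hkl.symm
  · exact (h.change_left hE hij hkj).change_right hE hkj hkl.symm

/-- The group of the permutations that are translations between any two coordinates. -/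
def translations (hE : IsRatioSystem E) (hm : 3 ≤ m) : Subgroup (Equiv.Perm Ω) where
  carrier := {t | ∀ i j, i ≠ j → IsTranslation E i j t}
  one_mem' i j _ u v hu hv := hE.of_diag _ _ _ _ (by simpa using hu.symm) (by simpa using hv.symm)
  inv_mem' h i j hij := (h j i hij.symm).inv hE
  mul_mem' {t s} ht hs := by
    classical
    let a : Fin m := ⟨0, by omega⟩
    let b : Fin m := ⟨1, by omega⟩
    let c : Fin m := ⟨2, by omega⟩
    have hab : a ≠ b := by simp [a, b]
    have hac : a ≠ c := by simp [a, c]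
    have hbc : b ≠ c := by simp [b, c]
    have h : IsTranslation E a c (t * s) := by
      intro u v hu hv
      have key : ∀ u : Fin m → Ω, E a c u (Function.update u b (s (u a))) := fun u =>
        hE.of_eq _ _ _ _ (by simp [hab]) (by simp [hbc.symm])
      refine (E a c).trans (key u) ((E a c).trans ?_ ((E a c).symm (key v)))
      refine hE.trans _ b _ _ _ (hs a b hab _ _ ?_ ?_) (ht b c hbc _ _ ?_ ?_)
      · simp [hab]
      · simp [hab]
      · simp [hbc.symm, hu]
      · simp [hbc.symm, hv]
    exact fun i j hij => h.change hE hm hac hij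

lemma translations_apply_eq (hE : IsRatioSystem E) (hm : 3 ≤ m) {t s : Equiv.Perm Ω}
    (ht : t ∈ translations hE hm) (hs : s ∈ translations hE hm) {a : Ω} (h : t a = s a) :
    t = s := by
  classical
  let i : Fin m := ⟨0, by omega⟩
  let j : Fin m := ⟨1, by omega⟩
  have hij : i ≠ j := by simp [i, j]
  ext x
  let p : Ω → Ω → Fin m → Ω := fun x y => Function.update (fun _ => x) j y
  have hpi : ∀ x y, p x y i = x := fun x y => by simp [p, hij]
  have hpj : ∀ x y, p x y j = y := fun x y => by simp [p]
  have h1 : E i j (p x (t x)) (p a (t a)) := ht i j hij _ _ (by simp [hpi, hpj]) (by simp [hpi, hpj])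
  have h2 : E i j (p a (t a)) (p x (s x)) :=
    hs i j hij _ _ (by simp [hpi, hpj, h]) (by simp [hpi, hpj])
  have h3 := hE.eq_of_eq _ _ _ _ ((E i j).trans h1 h2) (by simp [hpi])
  simpa [hpj] using h3

lemma exists_translations_apply [Finite Ω] (hE : IsRatioSystem E) (hm : 3 ≤ m) (a b : Ω) :
    ∃ t ∈ translations hE hm, t a = b := by
  classical
  let i : Fin m := ⟨0, by omega⟩
  let j : Fin m := ⟨1, by omega⟩
  have hij : i ≠ j := by simp [i, j]
  let q : Fin m → Ω := Function.update (fun _ => a) j b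
  have hqi : q i = a := by simp [q, hij]
  have hqj : q j = b := by simp [q]
  choose w hw1 hw2 using hE.exists_rel i j hij q
  have hinj : Function.Injective fun x => w x j := by
    intro x y hxy
    have : E j i (w x) (w y) := hE.symm _ _ _ _ ((E i j).trans (hw2 x) ((E i j).symm (hw2 y)))
    have := hE.eq_of_eq _ _ _ _ this hxy
    rwa [hw1, hw1] at this
  refine ⟨Equiv.ofBijective _ (Finite.injective_iff_bijective.1 hinj), ?_, ?_⟩
  · intro k l hkl
    refine IsTranslation.change hE hm hij (fun u v hu hv => ?_) hkl
    have key : ∀ u : Fin m → Ω, u j = w (u i) j → E i j u q := fun u hu =>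
      (E i j).trans (hE.of_eq _ _ _ _ (hw1 _).symm hu) (hw2 (u i))
    exact (E i j).trans (key u hu) ((E i j).symm (key v hv))
  · have := hE.eq_of_eq _ _ _ _ (hw2 a) (by rw [hw1, hqi])
    simpa [hqj] using this

/-- A ratio system on at least three coordinates comes from a group, namely the
group of translations, which acts regularly on the set `Ω`. -/
theorem exists_group [Finite Ω] (hE : IsRatioSystem E) (hm : 3 ≤ m) (o : Ω) :
    ∃ (K : Type u) (_ : Group K) (e : K ≃ Ω), e 1 = o ∧
      ∀ i j, i ≠ j → ∀ u v : Fin m → K,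
        E i j (fun k => e (u k)) (fun k => e (v k)) ↔ u i * (v i)⁻¹ = u j * (v j)⁻¹ := by
  let T := translations hE hm
  -- Without the inverse in `f`, the classes of `E i j` would be given by the ratios `v⁻¹ * u`.
  let f : T → Ω := fun t => (t⁻¹ : T).1 o
  have hf : Function.Bijective f := by
    constructor
    · intro t s hts
      have := translations_apply_eq hE hm (t⁻¹).2 (s⁻¹).2 hts
      exact inv_injective (Subtype.ext this)
    · intro b
      obtain ⟨t, ht, hb⟩ := exists_translations_apply hE hm o b
      exact ⟨(⟨t, ht⟩ : T)⁻¹, by simp only [f, inv_inv, hb]⟩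
  refine ⟨T, inferInstance, Equiv.ofBijective f hf, rfl, fun i j hij u v => ?_⟩
  have hk : ∀ u : Fin m → T, f (u j) = ((u j)⁻¹ * u i).1 (f (u i)) := fun u => by
    simp [f]
  have hiff : u i * (v i)⁻¹ = u j * (v j)⁻¹ ↔ (u j)⁻¹ * u i = (v j)⁻¹ * v i := by
    rw [mul_inv_eq_iff_eq_mul, inv_mul_eq_iff_eq_mul, mul_assoc]
  rw [hiff]
  constructor
  · intro h
    have h1 : E i j (fun k => f (u k))
        (Function.update (fun _ => f (v i)) j (((u j)⁻¹ * u i).1 (f (v i)))) :=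
      ((u j)⁻¹ * u i).2 i j hij _ _ (hk u) (by simp [hij])
    have h2 := hE.eq_of_eq _ _ _ _ ((E i j).trans ((E i j).symm h) h1) (by simp [hij])
    simp only [Equiv.ofBijective_apply, Function.update_self] at h2
    rw [hk v] at h2
    exact Subtype.ext (translations_apply_eq hE hm (Subtype.property _) (Subtype.property _) h2.symm)
  · intro h
    exact ((u j)⁻¹ * u i).2 i j hij _ _ (hk u) (h ▸ hk v)

end IsRatioSystem

end Coordinates

/-! ### Partitions and bijections between their classes -/

section Partitions

lemma isAtLeastAsFine_classes {α : Type u} {r s : Setoid α} (h : r ≤ s) :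
    IsAtLeastAsFine r.classes s.classes := by
  refine ⟨r.isPartition_classes, s.isPartition_classes, ?_⟩
  rintro _ ⟨y, rfl⟩
  refine ⟨{X | ∃ x, s x y ∧ X = {z | r z x}}, ?_, Set.ext fun x => ⟨fun hx => ?_, ?_⟩⟩
  · rintro _ ⟨x, -, rfl⟩
    exact r.mem_classes x
  · exact ⟨_, ⟨x, hx, rfl⟩, r.refl x⟩
  · rintro ⟨_, ⟨z, hz, rfl⟩, hx⟩
    exact s.trans (h hx) hz

variable {α : Type u} {β : Type v} {r : Setoid α} {s : Setoid β}

lemma mem_class_iff {X : Set α} (hX : X ∈ r.classes) {x : α} (hx : x ∈ X) {y : α} :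
    y ∈ X ↔ r y x := by
  obtain ⟨z, rfl⟩ := hX
  exact ⟨fun hy => r.trans hy (r.symm hx), fun hy => r.trans hy hx⟩

/-- The class of `x`, as an element of the type of classes. -/
def classOf (r : Setoid α) (x : α) : r.classes := ⟨{y | r y x}, r.mem_classes x⟩

lemma mem_classOf {x y : α} : y ∈ (classOf r x : Set α) ↔ r y x := Iff.rfl

lemma self_mem_classOf (x : α) : x ∈ (classOf r x : Set α) := r.refl x

lemma eq_classOf_iff {X : r.classes} {x : α} : X = classOf r x ↔ x ∈ (X : Set α) := by
  constructor
  · rintro rfl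
    exact self_mem_classOf x
  · intro hx
    exact Subtype.ext (Setoid.eq_of_mem_classes X.2 hx (r.mem_classes x) (r.refl x))

lemma classOf_eq_iff {x y : α} : classOf r x = classOf r y ↔ r x y := by
  rw [eq_classOf_iff, mem_classOf]
  exact ⟨r.symm, r.symm⟩

/-- A bitotal relation that is compatible with two partitions induces a bijection between their
classes. -/
lemma exists_classes_equiv {R : α → β → Prop} (hl : ∀ x, ∃ y, R x y) (hr : ∀ y, ∃ x, R x y)
    (h : ∀ x x' y y', R x y → R x' y' → (r x x' ↔ s y y')) :
    ∃ φ : r.classes ≃ s.classes, ∀ x y, R x y → φ (classOf r x) = classOf s y := by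
  choose f hf using hl
  choose g hg using hr
  choose p hp using fun X : r.classes => (X.2 : ∃ y, (X : Set α) = {x | r x y})
  choose q hq using fun X : s.classes => (X.2 : ∃ y, (X : Set β) = {x | s x y})
  have hp' : ∀ X, X = classOf r (p X) := fun X => Subtype.ext (hp X)
  have hq' : ∀ X, X = classOf s (q X) := fun X => Subtype.ext (hq X)
  have h1 : ∀ x y, R x y → classOf s (f (p (classOf r x))) = classOf s y := fun x y hxy =>
    classOf_eq_iff.2 ((h _ _ _ _ (hf _) hxy).1 (classOf_eq_iff.1 (hp' _).symm))
  have h2 : ∀ x y, R x y → classOf r (g (q (classOf s y))) = classOf r x := fun x y hxy =>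
    classOf_eq_iff.2 ((h _ _ _ _ (hg _) hxy).2 (classOf_eq_iff.1 (hq' _).symm))
  refine ⟨⟨fun X => classOf s (f (p X)), fun Y => classOf r (g (q Y)), fun X => ?_, fun Y => ?_⟩, h1⟩
  · conv_rhs => rw [hp' X]
    exact h2 _ _ (hf _)
  · conv_rhs => rw [hq' Y]
    exact h1 _ _ (hg _)

/-- Two colorings with equally many points of each color differ by a bijection. -/
lemma exists_equiv_of_ncard_eq {γ : Type w} [Finite α] [Finite β] (f : α → γ) (g : β → γ)
    (h : ∀ c, {a | f a = c}.ncard = {b | g b = c}.ncard) : ∃ π : α ≃ β, ∀ a, g (π a) = f a := by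
  have e : ∀ c, Nonempty ({a // f a = c} ≃ {b // g b = c}) := fun c =>
    Finite.card_eq.1 (h c)
  exact ⟨Equiv.ofFiberEquiv fun c => (e c).some, Equiv.ofFiberEquiv_map _⟩

end Partitions

/-! ### Schur bisimulations and algebraic isomorphisms of S-rings -/

section SchurBisimulation

variable {A : Type u} {B : Type v} {C : Type w} [Group A] [Group B] [Group C]

/-- A relation between two groups is a Schur bisimulation if, for related `z` and `z'`, the
factorizations of `z` and of `z'` into two factors can be matched so that the factors are related,
and if the relation respects inverses and the identity elements. The relations "`x` and `y` lie in
the same basic set" and "`φ` takes the basic set of `x` to that of `y`" are of this kind. -/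
structure IsSchurBisim (R : A → B → Prop) : Prop where
  mul : ∀ z z', R z z' → ∃ π : A ≃ B, ∀ x, R x (π x) ∧ R (z * x⁻¹) (z' * (π x)⁻¹)
  inv : ∀ z z', R z z' → R z⁻¹ z'⁻¹
  one : ∀ z z', R z z' → (z = 1 ↔ z' = 1)

namespace IsSchurBisim

lemma swap {R : A → B → Prop} (h : IsSchurBisim R) : IsSchurBisim fun y x => R x y where
  mul z z' hz := by
    obtain ⟨π, hπ⟩ := h.mul _ _ hz
    exact ⟨π.symm, fun x => by simpa using hπ (π.symm x)⟩
  inv z z' hz := h.inv _ _ hz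
  one z z' hz := (h.one _ _ hz).symm

lemma comp {R : A → B → Prop} {S : B → C → Prop} (hR : IsSchurBisim R) (hS : IsSchurBisim S) :
    IsSchurBisim fun x z => ∃ y, R x y ∧ S y z where
  mul := by
    rintro z z' ⟨y, h1, h2⟩
    obtain ⟨π, hπ⟩ := hR.mul _ _ h1
    obtain ⟨ρ, hρ⟩ := hS.mul _ _ h2
    exact ⟨π.trans ρ, fun x => ⟨⟨_, (hπ x).1, (hρ _).1⟩, ⟨_, (hπ x).2, (hρ _).2⟩⟩⟩
  inv := by
    rintro z z' ⟨y, h1, h2⟩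
    exact ⟨_, hR.inv _ _ h1, hS.inv _ _ h2⟩
  one := by
    rintro z z' ⟨y, h1, h2⟩
    exact (hR.one _ _ h1).trans (hS.one _ _ h2)

lemma of_mulEquiv (e : A ≃* B) : IsSchurBisim fun x y => e x = y where
  mul := by
    rintro z _ rfl
    exact ⟨e.toEquiv, fun x => by simp⟩
  inv := by
    rintro z _ rfl
    simp
  one := by
    rintro z _ rfl
    simp

end IsSchurBisim

lemma coeff_mul_eq_sum [Fintype A] (a b : MonoidAlgebra ℤ A) (z : A) :
    (a * b).coeff z = ∑ x, a.coeff (z * x⁻¹) * b.coeff x := by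
  rw [MonoidAlgebra.coeff_mul_apply_right, Finsupp.sum_fintype]
  simp

/-- A Schur bisimulation preserves the coefficients of products. -/
lemma IsSchurBisim.coeff_mul_eq [Finite A] [Finite B] {R : A → B → Prop} (hR : IsSchurBisim R)
    {a b : MonoidAlgebra ℤ A} {a' b' : MonoidAlgebra ℤ B}
    (ha : ∀ x y, R x y → a.coeff x = a'.coeff y) (hb : ∀ x y, R x y → b.coeff x = b'.coeff y)
    {z : A} {z' : B} (h : R z z') : (a * b).coeff z = (a' * b').coeff z' := by
  have := Fintype.ofFinite A
  have := Fintype.ofFinite B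
  obtain ⟨π, hπ⟩ := hR.mul _ _ h
  rw [coeff_mul_eq_sum, coeff_mul_eq_sum, ← π.sum_comp]
  exact Finset.sum_congr rfl fun x _ => by rw [ha _ _ (hπ x).2, hb _ _ (hπ x).1]

variable [Finite A] [Finite B]

lemma IsSchurBisim.isSchurPartition {r : Setoid A} (h : IsSchurBisim r) : IsSchurPartition r where
  one_mem := ⟨1, Set.ext fun x => ⟨fun hx => hx ▸ r.refl 1, fun hx => (h.one _ _ hx).2 rfl⟩⟩
  inv_mem := by
    rintro _ ⟨y, rfl⟩
    refine ⟨y⁻¹, Set.ext fun x => ⟨fun hx => ?_, fun hx => ?_⟩⟩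
    · simpa using h.inv _ _ hx
    · simpa using h.inv _ _ hx
  mul_mem X hX Y hY := by
    have key : ∀ X ∈ r.classes, ∀ x y, r x y → (setSum X).coeff x = (setSum X).coeff y :=
      fun X hX => mem_classSpan.1 (Submodule.subset_span (Set.mem_image_of_mem setSum hX))
    exact mem_classSpan.2 fun x y hxy => h.coeff_mul_eq (key X hX) (key Y hY) hxy

/-- The coefficient of a product of two class sums counts factorizations. -/
lemma coeff_setSum_mul_setSum (X Y : Set A) (z : A) :
    (setSum X * setSum Y).coeff z = ({x | x ∈ Y ∧ z * x⁻¹ ∈ X}.ncard : ℤ) := by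
  classical
  have := Fintype.ofFinite A
  rw [coeff_mul_eq_sum, Set.ncard_eq_toFinset_card']
  simp only [setSum_coeff, Set.toFinset_ofPred]
  rw [Finset.card_filter]
  push_cast
  refine Finset.sum_congr rfl fun x _ => ?_
  by_cases h1 : x ∈ Y <;> by_cases h2 : z * x⁻¹ ∈ X <;> simp [h1, h2]

lemma setSum_injective : Function.Injective (setSum : Set A → MonoidAlgebra ℤ A) := by
  classical
  intro X Y h
  ext x
  have : (setSum X).coeff x = (setSum Y).coeff x := by rw [h]
  rw [setSum_coeff, setSum_coeff] at this
  by_cases h1 : x ∈ X <;> by_cases h2 : x ∈ Y <;> simp_all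

namespace SchurRing

lemma basicElt_injective (S : SchurRing A) : Function.Injective S.basicElt := fun _ _ h =>
  Subtype.ext (setSum_injective (congrArg Subtype.val h))

variable {S : SchurRing A} {T : SchurRing B}

/-- The basic set that contains `x`. -/
def basicSet (S : SchurRing A) (x : A) : S.basicSets := classOf S.rel x

lemma basicElt_basicSet_inj {x y : A} :
    S.basicElt (S.basicSet x) = S.basicElt (S.basicSet y) ↔ S.rel x y :=
  S.basicElt_injective.eq_iff.trans classOf_eq_iff

lemma coeff_basicElt (x y : A) [Decidable (S.rel y x)] :
    (S.basicElt (S.basicSet x) : MonoidAlgebra ℤ A).coeff y = if S.rel y x then 1 else 0 :=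
  setSum_coeff {z | S.rel z x} y

lemma basicElt_one : S.basicElt (S.basicSet 1) = 1 := by
  refine Subtype.ext ?_
  have : (S.basicSet 1 : Set A) = {1} := Setoid.eq_of_mem_classes (S.basicSet 1).2
    (self_mem_classOf 1) S.isSchurPartition.one_mem rfl
  change setSum (S.basicSet 1 : Set A) = 1
  rw [this, one_eq_setSum]

lemma toSubring_induction {P : S.toSubring → Prop} (basic : ∀ x, P (S.basicElt (S.basicSet x)))
    (zero : P 0) (add : ∀ a b, P a → P b → P (a + b)) (smul : ∀ (c : ℤ) a, P a → P (c • a))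
    (a : S.toSubring) : P a := by
  obtain ⟨a, ha⟩ := a
  refine Submodule.span_induction (p := fun a (ha : a ∈ classSpan S.rel) => P ⟨a, ha⟩)
    ?_ zero (fun a b _ _ iha ihb => add _ _ iha ihb) ?_ ha
  · rintro _ ⟨_, ⟨x, rfl⟩, rfl⟩
    exact basic x
  · intro c a ha ih
    have : c • (⟨a, ha⟩ : S.toSubring) = ⟨c • a, Submodule.smul_mem _ c ha⟩ := by
      ext
      simp
    exact this ▸ smul c _ ih

/-- The points `x` and `y` lie in basic sets that correspond to each other under `φ`. -/
def Corresponds (φ : S.toSubring ≃+* T.toSubring) (x : A) (y : B) : Prop :=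
  φ (S.basicElt (S.basicSet x)) = T.basicElt (T.basicSet y)

section

variable {φ : S.toSubring ≃+* T.toSubring}

lemma Corresponds.rel_iff {x x' : A} {y y' : B} (h : Corresponds φ x y) (h' : Corresponds φ x' y') :
    S.rel x x' ↔ T.rel y y' := by
  rw [← basicElt_basicSet_inj, ← basicElt_basicSet_inj, ← h, ← h', φ.injective.eq_iff]

lemma Corresponds.of_rel {x x' : A} {y y' : B} (h : Corresponds φ x y) (hx : S.rel x x')
    (hy : T.rel y y') : Corresponds φ x' y' := by
  unfold Corresponds
  rw [← basicElt_basicSet_inj.2 hx, ← basicElt_basicSet_inj.2 hy]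
  exact h

variable (hφ : IsAlgebraicIso φ)
include hφ

lemma IsAlgebraicIso.exists_right (x : A) : ∃ y, Corresponds φ x y := by
  obtain ⟨⟨_, y, rfl⟩, hY⟩ := hφ (S.basicSet x)
  exact ⟨y, hY⟩

lemma IsAlgebraicIso.coeff_eq (a : S.toSubring) {x : A} {y : B} (h : Corresponds φ x y) :
    (φ a : MonoidAlgebra ℤ B).coeff y = (a : MonoidAlgebra ℤ A).coeff x := by
  classical
  induction a using toSubring_induction with
  | basic x' =>
    obtain ⟨y', hy'⟩ := hφ.exists_right x'
    rw [hy', coeff_basicElt, coeff_basicElt]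
    simp only [h.rel_iff hy']
  | zero => simp
  | add a b iha ihb => simp [iha, ihb]
  | smul c a ih =>
    rw [map_zsmul, AddSubgroupClass.coe_zsmul, AddSubgroupClass.coe_zsmul,
      MonoidAlgebra.coeff_smul_apply, MonoidAlgebra.coeff_smul_apply, ih]

lemma IsAlgebraicIso.exists_left (y : B) : ∃ x, Corresponds φ x y := by
  classical
  by_contra! hy
  -- Otherwise the coefficient at `y` vanishes on the whole image of `φ`.
  have key : ∀ a : S.toSubring, (φ a : MonoidAlgebra ℤ B).coeff y = 0 := by
    intro a
    induction a using toSubring_induction with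
    | basic x' =>
      obtain ⟨y', hy'⟩ := hφ.exists_right x'
      rw [hy', coeff_basicElt,
        if_neg fun h => hy x' (hy'.of_rel (S.rel.refl _) (T.rel.symm h))]
    | zero => simp
    | add a b iha ihb => simp [iha, ihb]
    | smul c a ih =>
      rw [map_zsmul, AddSubgroupClass.coe_zsmul, MonoidAlgebra.coeff_smul_apply, ih, smul_zero]
  have := key (φ.symm (T.basicElt (T.basicSet y)))
  rw [φ.apply_symm_apply, coeff_basicElt, if_pos (T.rel.refl y)] at this
  exact one_ne_zero this

/-- The points of corresponding basic sets have equally many factorizations of each type. -/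
theorem IsAlgebraicIso.isSchurBisim : IsSchurBisim (Corresponds φ) := by
  classical
  have hmul : ∀ z z', Corresponds φ z z' →
      ∃ π : A ≃ B, ∀ x, Corresponds φ x (π x) ∧ Corresponds φ (z * x⁻¹) (z' * (π x)⁻¹) := by
    intro z z' hz
    choose f hf using hφ.exists_right
    obtain ⟨π, hπ⟩ := exists_equiv_of_ncard_eq
      (fun x : A => (classOf T.rel (f x), classOf T.rel (f (z * x⁻¹))))
      (fun y : B => (classOf T.rel y, classOf T.rel (z' * y⁻¹))) (by
        rintro ⟨⟨_, q, rfl⟩, ⟨_, p, rfl⟩⟩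
        obtain ⟨b, hb⟩ := hφ.exists_left q
        obtain ⟨a, ha⟩ := hφ.exists_left p
        have h1 := hφ.coeff_eq (S.basicElt (S.basicSet a) * S.basicElt (S.basicSet b)) hz
        rw [φ.map_mul, ha, hb] at h1
        have h2 : (setSum {y | T.rel y p} * setSum {y | T.rel y q}).coeff z' =
          (setSum {x | S.rel x a} * setSum {x | S.rel x b}).coeff z := h1
        rw [coeff_setSum_mul_setSum, coeff_setSum_mul_setSum] at h2
        have h3 := (Nat.cast_injective (R := ℤ) h2).symm
        have e1 : ∀ x, classOf T.rel (f x) = ⟨{y | T.rel y q}, T.rel.mem_classes q⟩ ↔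
          S.rel x b := fun x => (classOf_eq_iff (y := q)).trans ((hf x).rel_iff hb).symm
        have e2 : ∀ x, classOf T.rel (f x) = ⟨{y | T.rel y p}, T.rel.mem_classes p⟩ ↔
          S.rel x a := fun x => (classOf_eq_iff (y := p)).trans ((hf x).rel_iff ha).symm
        have e3 : ∀ y, classOf T.rel y = ⟨{y | T.rel y q}, T.rel.mem_classes q⟩ ↔
          T.rel y q := fun y => classOf_eq_iff (y := q)
        have e4 : ∀ y, classOf T.rel y = ⟨{y | T.rel y p}, T.rel.mem_classes p⟩ ↔
          T.rel y p := fun y => classOf_eq_iff (y := p)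
        simp only [Prod.mk.injEq, e1, e2, e3, e4]
        exact h3)
    refine ⟨π, fun x => ?_⟩
    have h := hπ x
    simp only [Prod.mk.injEq] at h
    exact ⟨(hf x).of_rel (S.rel.refl _) (T.rel.symm (classOf_eq_iff.1 h.1)),
      (hf _).of_rel (S.rel.refl _) (T.rel.symm (classOf_eq_iff.1 h.2))⟩
  have hone : Corresponds φ 1 1 := by
    unfold Corresponds
    rw [basicElt_one, basicElt_one, φ.map_one]
  refine ⟨hmul, fun z z' hz => ?_, fun z z' hz => ⟨?_, ?_⟩⟩
  · obtain ⟨π, hπ⟩ := hmul 1 1 hone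
    have h := hπ z
    rw [one_mul, one_mul] at h
    exact h.2.of_rel (S.rel.refl _) (T.isSchurPartition.rel_inv ((h.1.rel_iff hz).1 (S.rel.refl _)))
  · rintro rfl
    exact (T.isSchurPartition.rel_one ((hone.rel_iff hz).1 (S.rel.refl _))).1 rfl
  · rintro rfl
    exact (S.isSchurPartition.rel_one ((hone.rel_iff hz).2 (T.rel.refl _))).1 rfl

end

lemma corresponds_refl {x y : A} : Corresponds (RingEquiv.refl S.toSubring) x y ↔ S.rel x y := by
  unfold Corresponds
  rw [RingEquiv.refl_apply, basicElt_basicSet_inj]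

lemma isSchurBisim_rel (S : SchurRing A) : IsSchurBisim S.rel := by
  have h := IsAlgebraicIso.isSchurBisim (φ := RingEquiv.refl S.toSubring) fun X => ⟨X, rfl⟩
  have e : Corresponds (RingEquiv.refl S.toSubring) = S.rel := by
    ext x y
    exact corresponds_refl
  rwa [e] at h

/-- A bitotal Schur bisimulation that is compatible with the partitions into basic sets yields an
algebraic isomorphism. -/
theorem exists_isAlgebraicIso {R : A → B → Prop} (hR : IsSchurBisim R) (hl : ∀ x, ∃ y, R x y)
    (hrel : ∀ x x' y y', R x y → R x' y' → (S.rel x x' ↔ T.rel y y')) :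
    ∃ φ : S.toSubring ≃+* T.toSubring, IsAlgebraicIso φ ∧ ∀ x y, R x y → Corresponds φ x y := by
  classical
  obtain ⟨y₁, hy₁⟩ := hl 1
  obtain ⟨π, hπ⟩ := hR.mul _ _ hy₁
  replace hπ := fun x => (hπ x).1
  have coeff_map : ∀ (a : MonoidAlgebra ℤ A) x,
      (MonoidAlgebra.mapDomain π a).coeff (π x) = a.coeff x := fun a x => by
    rw [MonoidAlgebra.coeff_mapDomain, Finsupp.mapDomain_apply π.injective]
  have coeff_map' : ∀ (b : MonoidAlgebra ℤ B) y,
      (MonoidAlgebra.mapDomain π.symm b).coeff y = b.coeff (π y) := fun b y => by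
    rw [MonoidAlgebra.coeff_mapDomain]
    conv_lhs => rw [← π.symm_apply_apply y]
    rw [Finsupp.mapDomain_apply π.symm.injective]
  have mem_map : ∀ a ∈ S.toSubring, MonoidAlgebra.mapDomain π a ∈ T.toSubring := by
    intro a ha
    refine mem_classSpan.2 fun x y hxy => ?_
    obtain ⟨x, rfl⟩ := π.surjective x
    obtain ⟨y, rfl⟩ := π.surjective y
    rw [coeff_map, coeff_map]
    exact mem_classSpan.1 ha x y ((hrel _ _ _ _ (hπ x) (hπ y)).2 hxy)
  have mem_map' : ∀ b ∈ T.toSubring, MonoidAlgebra.mapDomain π.symm b ∈ S.toSubring := by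
    intro b hb
    refine mem_classSpan.2 fun x y hxy => ?_
    rw [coeff_map', coeff_map']
    exact mem_classSpan.1 hb _ _ ((hrel _ _ _ _ (hπ x) (hπ y)).1 hxy)
  have coeff_rel : ∀ a ∈ S.toSubring, ∀ x y, R x y →
      a.coeff x = (MonoidAlgebra.mapDomain π a).coeff y := by
    intro a ha x y hxy
    rw [← coeff_map a x]
    exact mem_classSpan.1 (mem_map a ha) _ _
      ((hrel _ _ _ _ (hπ x) hxy).1 (S.rel.refl x))
  let φ : S.toSubring ≃+* T.toSubring :=
    { toFun := fun a => ⟨MonoidAlgebra.mapDomain π a, mem_map a a.2⟩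
      invFun := fun b => ⟨MonoidAlgebra.mapDomain π.symm b, mem_map' b b.2⟩
      left_inv := fun a => by
        ext x
        exact (coeff_map' _ x).trans (coeff_map _ x)
      right_inv := fun b => by
        ext y
        obtain ⟨x, rfl⟩ := π.surjective y
        exact (coeff_map _ x).trans (coeff_map' _ x)
      map_mul' := fun a b => by
        ext y
        obtain ⟨x, rfl⟩ := π.surjective y
        change (MonoidAlgebra.mapDomain π _).coeff (π x) = _
        rw [coeff_map]
        exact hR.coeff_mul_eq (coeff_rel a a.2) (coeff_rel b b.2) (hπ x)
      map_add' := fun a b => by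
        ext y
        obtain ⟨x, rfl⟩ := π.surjective y
        change (MonoidAlgebra.mapDomain π _).coeff (π x) =
          (MonoidAlgebra.mapDomain π _ + MonoidAlgebra.mapDomain π _).coeff (π x)
        rw [MonoidAlgebra.coeff_add, Finsupp.add_apply]
        simp only [coeff_map]
        simp }
  have hφ : ∀ x y, R x y → Corresponds φ x y := by
    intro x y hxy
    refine Subtype.ext ?_
    ext y'
    obtain ⟨x', rfl⟩ := π.surjective y'
    change (MonoidAlgebra.mapDomain π (setSum {z | S.rel z x})).coeff (π x') =
      (setSum {z | T.rel z y}).coeff (π x')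
    rw [coeff_map, setSum_coeff, setSum_coeff]
    simp only [Set.mem_ofPred_eq, hrel _ _ _ _ (hπ x') hxy]
  refine ⟨φ, ?_, hφ⟩
  rintro ⟨_, x, rfl⟩
  obtain ⟨y, hy⟩ := hl x
  exact ⟨classOf T.rel y, hφ x y hy⟩

end SchurRing

end SchurBisimulation

/-! ### The basic sets of the S-ring `𝔄_m(G)` as a largest bisimulation -/

section Power

variable {G : Type u} [Group G] {K : Type v} [Group K] {L : Type w} [Group L] {m : ℕ}

lemma comp_equiv_eq_one_iff (σ : Equiv.Perm (Fin m)) {x : Fin m → G} : x ∘ σ = 1 ↔ x = 1 := by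
  rw [← σ.surjective.injective_comp_right.eq_iff (a := x)]
  rfl

omit [Group G] in
lemma comp_equiv_mem_diag_iff (σ : Equiv.Perm (Fin m)) {x : Fin m → G} :
    x ∘ σ ∈ diag G m ↔ x ∈ diag G m :=
  exists_congr fun g => ⟨fun h i => by simpa using h (σ.symm i), fun h i => h _⟩

omit [Group G] in
lemma piecewise_comp_apply (J : Finset (Fin m)) (z : Fin m → G) {e : Fin m → Fin m} {j : Fin m}
    (he : e (e j) = e j) : J.piecewise (z ∘ e) z (e j) = (z ∘ e) j := by
  by_cases hj : e j ∈ J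
  · simp [hj, he]
  · simp [hj]

/-- A Schur bisimulation between `G ^ m` and `K ^ m` that respects the generators of the S-rings
`𝔄_m(G)` and `𝔄_m(K)`. -/
structure IsPowerBisim (R : (Fin m → G) → (Fin m → K) → Prop) : Prop extends IsSchurBisim R where
  eq_one : ∀ x y, R x y → ∀ i, x i = 1 ↔ y i = 1
  diag : ∀ x y, R x y → (x ∈ diag G m ↔ y ∈ diag K m)

/-- The largest Schur bisimulation between `G ^ m` and `K ^ m` that respects the generators. -/
def PowerRel (x : Fin m → G) (y : Fin m → K) : Prop :=
  ∃ R : (Fin m → G) → (Fin m → K) → Prop, IsPowerBisim R ∧ R x y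

lemma isPowerBisim_powerRel :
    IsPowerBisim (PowerRel : (Fin m → G) → (Fin m → K) → Prop) where
  mul := by
    rintro z z' ⟨R, hR, hz⟩
    obtain ⟨π, hπ⟩ := hR.mul _ _ hz
    exact ⟨π, fun x => ⟨⟨R, hR, (hπ x).1⟩, ⟨R, hR, (hπ x).2⟩⟩⟩
  inv := fun _ _ ⟨R, hR, hz⟩ => ⟨R, hR, hR.inv _ _ hz⟩
  one := fun _ _ ⟨_, hR, hz⟩ => hR.one _ _ hz
  eq_one := fun _ _ ⟨_, hR, hz⟩ => hR.eq_one _ _ hz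
  diag := fun _ _ ⟨_, hR, hz⟩ => hR.diag _ _ hz

lemma powerRel_of_mulEquiv (e : G ≃* K) (x : Fin m → G) : PowerRel x fun i => e (x i) := by
  refine ⟨_, { IsSchurBisim.of_mulEquiv (MulEquiv.piCongrRight fun _ : Fin m => e) with
    eq_one := ?_, diag := ?_ }, rfl⟩
  · rintro x _ rfl i
    simp
  · rintro x _ rfl
    constructor
    · rintro ⟨g, hg⟩
      exact ⟨e g, fun i => by simp [hg]⟩
    · rintro ⟨g, hg⟩
      exact ⟨e.symm g, fun i => by simp [← hg i]⟩

namespace PowerRel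

lemma refl (x : Fin m → G) : PowerRel x x := powerRel_of_mulEquiv (MulEquiv.refl G) x

lemma symm {x : Fin m → G} {y : Fin m → K} (h : PowerRel x y) : PowerRel y x := by
  obtain ⟨R, hR, h⟩ := h
  exact ⟨_, { hR.toIsSchurBisim.swap with
    eq_one := fun x y h i => (hR.eq_one _ _ h i).symm
    diag := fun x y h => (hR.diag _ _ h).symm }, h⟩

lemma trans {x : Fin m → G} {y : Fin m → K} {z : Fin m → L} (h : PowerRel x y)
    (h' : PowerRel y z) : PowerRel x z := by
  obtain ⟨R, hR, h⟩ := h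
  obtain ⟨S, hS, h'⟩ := h'
  exact ⟨_, { hR.toIsSchurBisim.comp hS.toIsSchurBisim with
    eq_one := fun x z ⟨y, h, h'⟩ i => (hR.eq_one _ _ h i).trans (hS.eq_one _ _ h' i)
    diag := fun x z ⟨y, h, h'⟩ => (hR.diag _ _ h).trans (hS.diag _ _ h') }, y, h, h'⟩

/-- A factorization `x = x w⁻¹ * w` of the left one of two related tuples can be carried over to
the right one. -/
lemma exists_factor {x : Fin m → G} {y : Fin m → K} (h : PowerRel x y) (w : Fin m → G) :
    ∃ w' : Fin m → K, PowerRel w w' ∧ PowerRel (x * w⁻¹) (y * w'⁻¹) := by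
  obtain ⟨π, hπ⟩ := isPowerBisim_powerRel.mul _ _ h
  exact ⟨π w, hπ w⟩

lemma eq_one {x : Fin m → G} {y : Fin m → K} (h : PowerRel x y) (i : Fin m) :
    x i = 1 ↔ y i = 1 := isPowerBisim_powerRel.eq_one _ _ h i

/-- If the factor `w` of `x` agrees with `x` at a coordinate, then so does the matching factor of
the related tuple. -/
lemma factor_apply_eq {x w : Fin m → G} {y w' : Fin m → K} (h : PowerRel (x * w⁻¹) (y * w'⁻¹))
    {i : Fin m} (hi : w i = x i) : w' i = y i := by
  have := (h.eq_one i).1 (by simp [hi])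
  exact (mul_inv_eq_one.1 this).symm

/-- The set `{x | x i = x j}` is a union of basic sets: it is the product of the diagonal and
`{x | x i = x j = 1}`. -/
lemma apply_eq_apply {x : Fin m → G} {y : Fin m → K} (h : PowerRel x y) {i j : Fin m}
    (hij : x i = x j) : y i = y j := by
  obtain ⟨w', h1, h2⟩ := h.exists_factor fun _ => x i
  obtain ⟨g, hg⟩ := (isPowerBisim_powerRel.diag _ _ h1).1 ⟨x i, fun _ => rfl⟩
  rw [← h2.factor_apply_eq (i := i) rfl, ← h2.factor_apply_eq (i := j) hij, hg, hg]

lemma apply_eq_apply_iff {x : Fin m → G} {y : Fin m → K} (h : PowerRel x y) (i j : Fin m) :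
    x i = x j ↔ y i = y j := ⟨h.apply_eq_apply, h.symm.apply_eq_apply⟩

/-- The set `{x | x i * x j = x k}` is a union of basic sets: it is the product of
`{x | x i = x k, x j = 1}` and `{x | x i = 1, x j = x k}`. -/
lemma mul_eq {x : Fin m → G} {y : Fin m → K} (h : PowerRel x y) {i j k : Fin m} (hij : i ≠ j)
    (hik : i ≠ k) (hx : x i * x j = x k) : y i * y j = y k := by
  obtain ⟨w', h1, h2⟩ := h.exists_factor fun l =>
    if l = i then 1 else if l = j ∨ l = k then x j else x l
  have e1 : w' i = 1 := (h1.eq_one i).1 (by simp)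
  have e2 : w' j = w' k := h1.apply_eq_apply (by simp [hij.symm, hik.symm])
  have e3 : (y * w'⁻¹) j = 1 := (h2.eq_one j).1 (by simp [hij.symm])
  have e4 : (y * w'⁻¹) i = (y * w'⁻¹) k := h2.apply_eq_apply (by simp [hik.symm, ← hx])
  simp only [Pi.mul_apply, Pi.inv_apply] at e3 e4
  rw [e1, inv_one, mul_one, ← e2, ← mul_inv_eq_one.1 e3] at e4
  rw [e4]
  simp

lemma mul_eq_iff {x : Fin m → G} {y : Fin m → K} (h : PowerRel x y) {i j k : Fin m} (hij : i ≠ j)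
    (hik : i ≠ k) : x i * x j = x k ↔ y i * y j = y k :=
  ⟨h.mul_eq hij hik, h.symm.mul_eq hij hik⟩

lemma update_one {x : Fin m → G} {y : Fin m → K} (h : PowerRel x y) (i : Fin m) :
    PowerRel (Function.update x i 1) (Function.update y i 1) := by
  obtain ⟨w', h1, h2⟩ := h.exists_factor (Function.update x i 1)
  convert h1 using 1
  ext j
  rcases eq_or_ne j i with rfl | hj
  · simp [(h1.eq_one j).1 (by simp)]
  · rw [Function.update_of_ne hj, h2.factor_apply_eq (by simp [hj])]

lemma update_apply {x : Fin m → G} {y : Fin m → K} (h : PowerRel x y) (i j : Fin m) :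
    PowerRel (Function.update x j (x i)) (Function.update y j (y i)) := by
  rcases eq_or_ne i j with rfl | hij
  · simpa using h
  obtain ⟨w', h1, h2⟩ := h.exists_factor (Function.update x j (x i))
  have hw : ∀ k, k ≠ j → w' k = y k := fun k hk => h2.factor_apply_eq (by simp [hk])
  convert h1 using 1
  ext k
  rcases eq_or_ne k j with rfl | hk
  · have : w' i = w' k := h1.apply_eq_apply (by simp [hij])
    rw [Function.update_self, ← this, hw i hij]
  · rw [Function.update_of_ne hk, hw k hk]

lemma comp_equiv {x : Fin m → G} {y : Fin m → K} (h : PowerRel x y) (σ : Equiv.Perm (Fin m)) :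
    PowerRel (x ∘ σ) (y ∘ σ) := by
  obtain ⟨R, hR, h⟩ := h
  refine ⟨fun x y => R (x ∘ σ.symm) (y ∘ σ.symm), ⟨⟨?_, ?_, ?_⟩, ?_, ?_⟩, ?_⟩
  · intro z z' hz
    obtain ⟨π, hπ⟩ := hR.mul _ _ hz
    refine ⟨(Equiv.arrowCongr σ (Equiv.refl G)).trans
      (π.trans (Equiv.arrowCongr σ.symm (Equiv.refl K))), fun x => ?_⟩
    have h1 := hπ (x ∘ σ.symm)
    refine ⟨?_, ?_⟩
    · convert h1.1 using 1
      ext i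
      simp [Equiv.arrowCongr, Function.comp_def]
    · convert h1.2 using 1 <;>
        · ext i
          simp [Equiv.arrowCongr, Function.comp_def]
  · exact fun z z' hz => hR.inv _ _ hz
  · intro z z' hz
    rw [← comp_equiv_eq_one_iff σ.symm, ← comp_equiv_eq_one_iff σ.symm (x := z')]
    exact hR.one _ _ hz
  · intro x y hxy i
    simpa using hR.eq_one _ _ hxy (σ i)
  · intro x y hxy
    rw [← comp_equiv_mem_diag_iff σ.symm, ← comp_equiv_mem_diag_iff σ.symm (x := y)]
    exact hR.diag _ _ hxy
  · simpa [Function.comp_assoc] using h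

/-- The largest bisimulation is closed under all maps between the coordinates: such a map is the
composition of a permutation and an idempotent map, which copies coordinates one at a time. -/
lemma comp {x : Fin m → G} {y : Fin m → K} (h : PowerRel x y) (σ : Fin m → Fin m) :
    PowerRel (x ∘ σ) (y ∘ σ) := by
  classical
  -- The map `e` takes each coordinate to a fixed representative of its fibre under `σ`.
  have hτ : ∀ i, ∃ j, σ j = σ i := fun i => ⟨i, rfl⟩
  let e : Fin m → Fin m := fun i => Function.extend σ id (fun i => i) (σ i)
  have hσe : ∀ i, σ (e i) = σ i := by
    intro i
    by_cases hi : ∃ j, σ j = σ i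
    · have : e i = Classical.choose hi := by
        simp only [e, Function.extend, dif_pos hi, id]
      rw [this]
      exact Classical.choose_spec hi
    · exact absurd (hτ i) hi
  have hee : ∀ i j, σ i = σ j → e i = e j := fun i j hij => by simp only [e, hij]
  have hinj : Set.InjOn σ (Set.range e) := by
    rintro _ ⟨i, rfl⟩ _ ⟨j, rfl⟩ hij
    rw [hσe, hσe] at hij
    exact hee _ _ hij
  obtain ⟨p, hp⟩ := Set.MapsTo.exists_equiv_extend_of_card_eq (t := (Finset.univ : Finset (Fin m)))
    (by simp) (fun i _ => by simp) hinj
  let q : Equiv.Perm (Fin m) := p.trans (Equiv.subtypeUnivEquiv (by simp))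
  have hq : σ = q ∘ e := by
    ext1 i
    have h1 := hp (e i) ⟨i, rfl⟩
    rw [hσe] at h1
    exact h1.symm
  rw [hq, ← Function.comp_assoc, ← Function.comp_assoc]
  have h' := h.comp_equiv q
  generalize x ∘ q = x at h'
  generalize y ∘ q = y at h'
  have key : ∀ J : Finset (Fin m),
      PowerRel (J.piecewise (x ∘ e) x) (J.piecewise (y ∘ e) y) := by
    intro J
    induction J using Finset.induction_on with
    | empty => simpa using h'
    | insert j J _ ih =>
      have he : e (e j) = e j := hee _ _ (hσe j)
      rw [Finset.piecewise_insert, Finset.piecewise_insert, 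
        ← piecewise_comp_apply J x he, ← piecewise_comp_apply J y he]
      exact ih.update_apply (e j) j
  simpa using key Finset.univ

end PowerRel

section Finite

variable [Finite G]

/-- The relation `PowerRel` is the partition of `G ^ m` into the basic sets of `𝔄_m(G)`. -/
theorem schurRingPower_rel_iff {x y : Fin m → G} :
    (schurRingPower G m).rel x y ↔ PowerRel x y := by
  classical
  constructor
  · intro h
    have hsub := SchurRing.subset_closure ((tensorPowerTrivial G m :
      Set (MonoidAlgebra ℤ (Fin m → G))) ∪ {setSum (diag G m)})
    have mem_iff : ∀ X : Set (Fin m → G), setSum X ∈ classSpan (schurRingPower G m).rel →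
        ∀ x y, (schurRingPower G m).rel x y → (x ∈ X ↔ y ∈ X) := by
      intro X hX x y hxy
      have := mem_classSpan.1 hX x y hxy
      rw [setSum_coeff, setSum_coeff] at this
      by_cases h1 : x ∈ X <;> by_cases h2 : y ∈ X <;> simp_all
    refine ⟨_, { SchurRing.isSchurBisim_rel (schurRingPower G m) with
      eq_one := fun x y hxy i => ?_, diag := fun x y hxy => ?_ }, h⟩
    · have := mem_iff {z | ∀ i, z i = 1 ↔ i ∈ {i | x i = 1}}
        (hsub (Or.inl (Submodule.subset_span ⟨_, rfl⟩))) x y hxy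
      exact ((this.1 fun i => Iff.rfl) i).symm
    · exact mem_iff _ (hsub (Or.inr rfl)) x y hxy
  · intro h
    let r : Setoid (Fin m → G) :=
      ⟨PowerRel, PowerRel.refl, PowerRel.symm, PowerRel.trans⟩
    have hr : r ≤ (schurRingPower G m).rel := by
      refine le_sSup ⟨isPowerBisim_powerRel.toIsSchurBisim.isSchurPartition, ?_⟩
      have key : ∀ X : Set (Fin m → G), (∀ x y, PowerRel x y → (x ∈ X ↔ y ∈ X)) →
          setSum X ∈ classSpan r := fun X hX => mem_classSpan.2 fun x y hxy => by
        rw [setSum_coeff, setSum_coeff]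
        simp only [hX x y hxy]
      rintro a (ha | rfl)
      · refine Submodule.span_le.2 ?_ ha
        rintro _ ⟨I, rfl⟩
        exact key _ fun x y hxy => forall_congr' fun i => by rw [hxy.eq_one]
      · exact key _ isPowerBisim_powerRel.diag
    exact hr h

end Finite

end Power

/-! ### The Weisfeiler-Leman partition as a largest bisimulation -/

section WeisfeilerLeman

variable {G : Type u} [Group G] {K : Type v} [Group K] {L : Type w} [Group L] {m n : ℕ}

/-- A relation between `G ^ m` and `K ^ m` that respects the atomic types of tuples, is closed under
maps between the coordinates, and has the back-and-forth property with respect to replacing one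
coordinate, where one bijection serves all the coordinates. -/
structure IsWLBisim (R : (Fin m → G) → (Fin m → K) → Prop) : Prop where
  eq_iff : ∀ x y, R x y → ∀ i j, x i = x j ↔ y i = y j
  mul_iff : ∀ x y, R x y → ∀ i j k, x i * x j = x k ↔ y i * y j = y k
  comp : ∀ x y, R x y → ∀ σ : Fin m → Fin m, R (x ∘ σ) (y ∘ σ)
  update : ∀ x y, R x y → ∃ π : G ≃ K, ∀ i α, R (Function.update x i α) (Function.update y i (π α))

/-- The largest bisimulation between `G ^ m` and `K ^ m`. -/
def WLRel (x : Fin m → G) (y : Fin m → K) : Prop :=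
  ∃ R : (Fin m → G) → (Fin m → K) → Prop, IsWLBisim R ∧ R x y

lemma isWLBisim_wlRel : IsWLBisim (WLRel : (Fin m → G) → (Fin m → K) → Prop) where
  eq_iff := fun _ _ ⟨_, hR, h⟩ => hR.eq_iff _ _ h
  mul_iff := fun _ _ ⟨_, hR, h⟩ => hR.mul_iff _ _ h
  comp := fun _ _ ⟨R, hR, h⟩ σ => ⟨R, hR, hR.comp _ _ h σ⟩
  update := by
    rintro x y ⟨R, hR, h⟩
    obtain ⟨π, hπ⟩ := hR.update _ _ h
    exact ⟨π, fun i α => ⟨R, hR, hπ i α⟩⟩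

namespace IsWLBisim

lemma swap {R : (Fin m → G) → (Fin m → K) → Prop} (hR : IsWLBisim R) :
    IsWLBisim fun y x => R x y where
  eq_iff := fun _ _ h i j => (hR.eq_iff _ _ h i j).symm
  mul_iff := fun _ _ h i j k => (hR.mul_iff _ _ h i j k).symm
  comp := fun _ _ h => hR.comp _ _ h
  update := by
    intro y x h
    obtain ⟨π, hπ⟩ := hR.update _ _ h
    exact ⟨π.symm, fun i α => by simpa using hπ i (π.symm α)⟩

/-- Any change of the left one of two related tuples can be matched by a change of the right one at
the same coordinates. -/
lemma exists_right {R : (Fin m → G) → (Fin m → K) → Prop} (hR : IsWLBisim R) {x : Fin m → G}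
    {y : Fin m → K} (h : R x y) (x' : Fin m → G) :
    ∃ y', R x' y' ∧ ∀ i, x i = x' i → y i = y' i := by
  classical
  have key : ∀ J : Finset (Fin m), ∃ y', R (J.piecewise x' x) y' ∧ ∀ i ∉ J, y i = y' i := by
    intro J
    induction J using Finset.induction_on with
    | empty => exact ⟨y, by simpa using h, fun _ _ => rfl⟩
    | insert j J hj ih =>
      obtain ⟨y', h1, h2⟩ := ih
      obtain ⟨π, hπ⟩ := hR.update _ _ h1
      refine ⟨Function.update y' j (π (x' j)), ?_, fun i hi => ?_⟩
      · rw [Finset.piecewise_insert]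
        exact hπ j _
      · rw [Finset.mem_insert, not_or] at hi
        rw [Function.update_of_ne hi.1, h2 i hi.2]
  obtain ⟨y', h1, h2⟩ := key {i | x i ≠ x' i}
  refine ⟨y', ?_, fun i hi => h2 i (by simpa using hi)⟩
  convert h1
  ext i
  by_cases hi : x i = x' i <;> simp [hi]

/-- Changes at several given coordinates can be matched bijectively. -/
lemma exists_equiv {R : (Fin n → G) → (Fin n → K) → Prop} (hR : IsWLBisim R) (k : ℕ)
    (ι : Fin k → Fin n) (hι : Function.Injective ι) {x : Fin n → G} {y : Fin n → K} (h : R x y) :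
    ∃ π : (Fin k → G) ≃ (Fin k → K), ∀ a, ∃ x' y', R x' y' ∧ x' ∘ ι = a ∧ y' ∘ ι = π a ∧
      ∀ i, i ∉ Set.range ι → x' i = x i ∧ y' i = y i := by
  induction k generalizing x y with
  | zero =>
    exact ⟨Equiv.ofUnique _ _, fun a => ⟨x, y, h, Subsingleton.elim _ _, Subsingleton.elim _ _,
      fun _ _ => ⟨rfl, rfl⟩⟩⟩
  | succ k ih =>
    obtain ⟨π, hπ⟩ := hR.update _ _ h
    have hι' : Function.Injective (ι ∘ Fin.succ) := hι.comp (Fin.succ_injective k)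
    choose ρ hρ using fun α => ih (ι ∘ Fin.succ) hι' (hπ (ι 0) α)
    have h0 : ι 0 ∉ Set.range (ι ∘ Fin.succ) := by
      rintro ⟨j, hj⟩
      exact Fin.succ_ne_zero j (hι hj)
    refine ⟨(Fin.consEquiv fun _ => G).symm.trans
      ((Equiv.prodShear π ρ).trans (Fin.consEquiv fun _ => K)), fun a => ?_⟩
    obtain ⟨x', y', h1, h2, h3, h4⟩ := hρ (a 0) (Fin.tail a)
    refine ⟨x', y', h1, ?_, ?_, fun i hi => ?_⟩
    · ext j
      refine Fin.cases ?_ (fun j => ?_) j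
      · simpa using (h4 _ h0).1
      · exact congrFun h2 j
    · ext j
      refine Fin.cases ?_ (fun j => ?_) j
      · simpa using (h4 _ h0).2
      · exact congrFun h3 j
    · have h5 := h4 i fun ⟨j, hj⟩ => hi ⟨j.succ, hj⟩
      have h6 : i ≠ ι 0 := fun h => hi ⟨0, h.symm⟩
      rwa [Function.update_of_ne h6, Function.update_of_ne h6] at h5

/-- Tuples are related if they are so after composition with a retraction of coordinates. -/
lemma of_retraction {R : (Fin n → G) → (Fin n → K) → Prop} (hR : IsWLBisim R) {τ : Fin n → Fin m}
    {ι : Fin m → Fin n} (hτ : ∀ i, τ (ι i) = i) :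
    IsWLBisim fun x y => R (x ∘ τ) (y ∘ τ) where
  eq_iff := fun x y h i j => by simpa [hτ] using hR.eq_iff _ _ h (ι i) (ι j)
  mul_iff := fun x y h i j k => by simpa [hτ] using hR.mul_iff _ _ h (ι i) (ι j) (ι k)
  comp := fun x y h σ => by
    have := hR.comp _ _ h (ι ∘ σ ∘ τ)
    convert this using 1 <;> · ext i; simp [hτ]
  update := fun x y h => by
    obtain ⟨π, hπ⟩ := hR.update _ _ h
    refine ⟨π, fun i α => ?_⟩
    have := hR.comp _ _ (hπ (ι i) α) (ι ∘ τ)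
    have hinj : Function.Injective ι := Function.LeftInverse.injective hτ
    convert this using 1 <;>
      · ext k
        by_cases hk : τ k = i
        · simp [hk]
        · simp [hk, hτ, hinj.eq_iff]

end IsWLBisim

namespace WLRel

lemma refl (x : Fin m → G) : WLRel x x := by
  refine ⟨Eq, ⟨?_, ?_, ?_, ?_⟩, rfl⟩
  · rintro x _ rfl
    simp
  · rintro x _ rfl
    simp
  · rintro x _ rfl
    simp
  · rintro x _ rfl
    exact ⟨Equiv.refl G, by simp⟩

lemma symm {x : Fin m → G} {y : Fin m → K} : WLRel x y → WLRel y x :=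
  fun ⟨_, hR, h⟩ => ⟨_, hR.swap, h⟩

lemma trans {x : Fin m → G} {y : Fin m → K} {z : Fin m → L} (h : WLRel x y) (h' : WLRel y z) :
    WLRel x z := by
  refine ⟨fun x z => ∃ y : Fin m → K, WLRel x y ∧ WLRel y z, ⟨?_, ?_, ?_, ?_⟩, y, h, h'⟩
  · rintro x z ⟨y, h, h'⟩ i j
    exact (isWLBisim_wlRel.eq_iff _ _ h i j).trans (isWLBisim_wlRel.eq_iff _ _ h' i j)
  · rintro x z ⟨y, h, h'⟩ i j k
    exact (isWLBisim_wlRel.mul_iff _ _ h i j k).trans (isWLBisim_wlRel.mul_iff _ _ h' i j k)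
  · rintro x z ⟨y, h, h'⟩ σ
    exact ⟨_, isWLBisim_wlRel.comp _ _ h σ, isWLBisim_wlRel.comp _ _ h' σ⟩
  · rintro x z ⟨y, h, h'⟩
    obtain ⟨π, hπ⟩ := isWLBisim_wlRel.update _ _ h
    obtain ⟨ρ, hρ⟩ := isWLBisim_wlRel.update _ _ h'
    exact ⟨π.trans ρ, fun i α => ⟨_, hπ i α, hρ i _⟩⟩

lemma comp {x : Fin m → G} {y : Fin m → K} (h : WLRel x y) (σ : Fin m → Fin m) :
    WLRel (x ∘ σ) (y ∘ σ) := isWLBisim_wlRel.comp _ _ h σ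

end WLRel

omit [Group G] [Group K] in
lemma tupleCount_eq_of_equiv {R : (Fin m → G) → (Fin m → K) → Prop} {x : Fin m → G}
    {y : Fin m → K} {π : G ≃ K}
    (hπ : ∀ i α, R (Function.update x i α) (Function.update y i (π α)))
    {X : Fin m → Set (Fin m → G)} {Y : Fin m → Set (Fin m → K)}
    (hXY : ∀ x y i, R x y → (x ∈ X i ↔ y ∈ Y i)) : tupleCount x X = tupleCount y Y := by
  refine Set.ncard_congr (fun α _ => π α) (fun α hα i => ?_) (fun _ _ _ _ h => π.injective h)
    fun β hβ => ⟨π.symm β, fun i => ?_, by simp⟩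
  · exact (hXY _ _ i (hπ i α)).1 (hα i)
  · refine (hXY _ _ i (hπ i _)).2 ?_
    simpa using hβ i

/-- The relation `WLRel` as a partition of `G ^ m`. -/
def wlSetoid (G : Type u) [Group G] (m : ℕ) : Setoid (Fin m → G) :=
  ⟨WLRel, WLRel.refl, WLRel.symm, WLRel.trans⟩

lemma isRainbow_wlSetoid : IsRainbow (wlSetoid G m) where
  eq_iff := by
    rintro _ ⟨z, rfl⟩ x hx y hy i j
    exact isWLBisim_wlRel.eq_iff _ _ (WLRel.trans hx (WLRel.symm hy)) i j
  comp_mem := by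
    classical
    rintro _ ⟨z, rfl⟩ σ
    refine ⟨z ∘ σ, Set.ext fun w => ⟨?_, fun hw => ?_⟩⟩
    · rintro ⟨x, hx, rfl⟩
      exact WLRel.comp hx σ
    · -- The tuple `w` is spread along a section of `σ`, and then `z` is changed to match.
      replace hw : WLRel w (z ∘ σ) := hw
      let τ : Fin m → Fin m := fun j => Function.extend σ id id j
      have hτ : ∀ i, σ (τ (σ i)) = σ i := fun i => by
        have hi : ∃ j, σ j = σ i := ⟨i, rfl⟩
        simp only [τ, Function.extend, dif_pos hi, id]
        exact Classical.choose_spec hi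
      obtain ⟨w', h1, h2⟩ := isWLBisim_wlRel.exists_right (hw.comp τ).symm z
      refine ⟨w', h1.symm, ?_⟩
      ext i
      have h3 := h2 (σ i) (by simp [hτ])
      change w' (σ i) = w i
      rw [← h3]
      exact (isWLBisim_wlRel.eq_iff _ _ hw _ _).2 (by simp [hτ])

lemma isCoherent_wlSetoid : IsCoherent (wlSetoid G m) where
  toIsRainbow := isRainbow_wlSetoid
  count_eq := by
    rintro _ ⟨z, rfl⟩ X hX x hx y hy
    have hxy : WLRel x y := WLRel.trans hx (WLRel.symm hy)
    obtain ⟨π, hπ⟩ := isWLBisim_wlRel.update _ _ hxy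
    refine tupleCount_eq_of_equiv hπ fun x y i h => ?_
    obtain ⟨z, hz⟩ := hX i
    rw [hz]
    exact ⟨fun h' => WLRel.trans (WLRel.symm h) h', fun h' => WLRel.trans h h'⟩

lemma wlSetoid_le_initialRainbow : wlSetoid G m ≤ initialRainbow m G := by
  refine le_sSup ⟨isRainbow_wlSetoid, ?_⟩
  rintro _ ⟨z, rfl⟩ x hx y hy
  have hxy : WLRel x y := WLRel.trans hx (WLRel.symm hy)
  exact ⟨isWLBisim_wlRel.eq_iff _ _ hxy, isWLBisim_wlRel.mul_iff _ _ hxy⟩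

lemma initialRainbow_mul_iff {x y : Fin m → G} (h : initialRainbow m G x y) (i j k : Fin m) :
    x i * x j = x k ↔ y i * y j = y k := by
  have hle : initialRainbow m G ≤ Setoid.ker fun (x : Fin m → G) i j k => x i * x j = x k := by
    refine sSup_le ?_
    rintro r ⟨-, hr⟩ x y hxy
    funext i j k
    exact propext ((hr _ (r.mem_classes y) x hxy y (r.refl y)).2 i j k)
  have h1 : (fun i j k => x i * x j = x k) = fun i j k => y i * y j = y k := hle h
  exact iff_of_eq (congrFun (congrFun (congrFun h1 i) j) k)

variable [Finite G] [Finite K]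

/-- A genuine algebraic isomorphism of rainbows, as a relation between the points, is a
bisimulation. -/
lemma isWLBisim_of_isAlgebraicIsoWL {r : Setoid (Fin m → G)} {s : Setoid (Fin m → K)}
    (hr : IsRainbow r) (hs : IsRainbow s) {φ : r.classes ≃ s.classes} (hφ : IsAlgebraicIsoWL φ)
    (hgen : IsGenuine φ) : IsWLBisim fun x y => φ (classOf r x) = classOf s y := by
  have comp : ∀ x y, φ (classOf r x) = classOf s y → ∀ σ : Fin m → Fin m,
      φ (classOf r (x ∘ σ)) = classOf s (y ∘ σ) := by
    intro x y h σ
    have h1 : (classOf r (x ∘ σ) : Set (Fin m → G)) = (fun x => x ∘ σ) '' (classOf r x) :=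
      Setoid.eq_of_mem_classes (classOf r (x ∘ σ)).2 (self_mem_classOf _)
        (hr.comp_mem _ (classOf r x).2 σ) ⟨x, self_mem_classOf x, rfl⟩
    have h2 := hφ.map_comp _ _ σ h1
    rw [h] at h2
    rw [eq_classOf_iff, h2]
    exact ⟨y, self_mem_classOf y, rfl⟩
  refine ⟨fun x y h i j => ?_, fun x y h => ?_, comp, fun x y h => ?_⟩
  · classical
    -- Two coordinates are equal if and only if replacing one of them by the other is harmless.
    have h1 := comp x y h (Function.update id j i)
    constructor
    · intro hij
      have e : x ∘ Function.update id j i = x := by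
        ext k
        rcases eq_or_ne k j with rfl | hk
        · simp [hij]
        · simp [hk]
      rw [e, h, classOf_eq_iff] at h1
      refine (hs.eq_iff _ (s.mem_classes _) y h1 _ (s.refl _) i j).2 ?_
      rcases eq_or_ne i j with rfl | hk
      · rfl
      · simp [hk]
    · intro hij
      have e : y ∘ Function.update id j i = y := by
        ext k
        rcases eq_or_ne k j with rfl | hk
        · simp [hij]
        · simp [hk]
      rw [e, ← h, φ.injective.eq_iff, classOf_eq_iff] at h1
      refine (hr.eq_iff _ (r.mem_classes _) _ h1 _ (r.refl _) i j).1 ?_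
      rcases eq_or_ne i j with rfl | hk
      · rfl
      · simp [hk]
  · exact hgen _ x (self_mem_classOf x) y (by rw [h]; exact self_mem_classOf y)
  · obtain ⟨π, hπ⟩ := exists_equiv_of_ncard_eq
      (fun α i => φ (classOf r (Function.update x i α)))
      (fun β i => classOf s (Function.update y i β)) (by
        intro c
        have h1 := hφ.map_count (classOf r x) (fun i => φ.symm (c i)) x (self_mem_classOf x) y
          (by rw [h]; exact self_mem_classOf y)
        unfold tupleCount at h1
        convert h1 using 3
        · ext α
          rw [funext_iff]
          refine forall_congr' fun i => ?_
          rw [← eq_classOf_iff, φ.symm_apply_eq, eq_comm]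
        · ext α
          rw [funext_iff]
          refine forall_congr' fun i => ?_
          rw [← eq_classOf_iff, φ.apply_symm_apply, eq_comm])
    exact ⟨π, fun i α => (congrFun (hπ α) i).symm⟩

/-- The Weisfeiler-Leman partition is the largest bisimulation. -/
theorem WL_eq_wlSetoid : WL m G = wlSetoid G m := by
  refine le_antisymm (sSup_le ?_) (le_sSup ⟨isCoherent_wlSetoid, wlSetoid_le_initialRainbow⟩)
  rintro r ⟨hr, hle⟩ x y hxy
  refine ⟨_, isWLBisim_of_isAlgebraicIsoWL hr.toIsRainbow hr.toIsRainbow (φ := Equiv.refl _)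
    ⟨fun X Y σ h => h, fun X₀ X x hx y hy => hr.count_eq _ X₀.2 _ (fun i => (X i).2) x hx y hy⟩
    fun X x hx y hy i j k => initialRainbow_mul_iff (hle ?_) i j k, classOf_eq_iff.2 hxy⟩
  exact (mem_class_iff X.2 hy).1 hx

lemma WL_iff {x y : Fin m → G} : WL m G x y ↔ WLRel x y := by
  rw [WL_eq_wlSetoid]
  rfl

lemma isRainbow_WL : IsRainbow (WL m G) := by
  rw [WL_eq_wlSetoid]
  exact isRainbow_wlSetoid

/-- Groups are Weisfeiler-Leman equivalent if and only if the largest bisimulation between them is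
nonempty; it is then bitotal. -/
theorem wlEquivalent_iff : WLEquivalent m G K ↔ ∃ (x : Fin m → G) (y : Fin m → K), WLRel x y := by
  constructor
  · rintro ⟨φ, h1, h2⟩
    obtain ⟨y, hy'⟩ : ∃ y, φ (classOf _ 1) = classOf _ y := by
      obtain ⟨y, hy⟩ := (φ (classOf _ 1)).2
      exact ⟨y, Subtype.ext hy⟩
    exact ⟨1, y, _, isWLBisim_of_isAlgebraicIsoWL isRainbow_WL isRainbow_WL h1 h2, hy'⟩
  · rintro ⟨x₀, y₀, h₀⟩
    have hl : ∀ x : Fin m → G, ∃ y : Fin m → K, WLRel x y := fun x =>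
      (isWLBisim_wlRel.exists_right h₀ x).imp fun _ h => h.1
    have hr : ∀ y : Fin m → K, ∃ x : Fin m → G, WLRel x y := fun y =>
      (isWLBisim_wlRel.exists_right h₀.symm y).imp fun _ h => h.1.symm
    obtain ⟨φ, hφ⟩ := exists_classes_equiv (r := WL m G) (s := WL m K) hl hr
      fun x x' y y' h h' => by
        rw [WL_iff, WL_iff]
        exact ⟨fun hx => h.symm.trans (hx.trans h'), fun hy => h.trans (hy.trans h'.symm)⟩
    have key : ∀ (X : (WL m G).classes) x y, x ∈ (X : Set (Fin m → G)) →
        (y ∈ (φ X : Set (Fin m → K)) ↔ WLRel x y) := by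
      intro X x y hx
      obtain ⟨y', hy'⟩ := hl x
      rw [eq_classOf_iff.2 hx, hφ x y' hy', mem_classOf, WL_iff]
      exact ⟨fun h => hy'.trans h.symm, fun h => h.symm.trans hy'⟩
    refine ⟨φ, ⟨fun X Y σ hXY => ?_, fun X₀ X x hx y hy => ?_⟩, fun X x hx y hy =>
      isWLBisim_wlRel.mul_iff _ _ ((key X x y hx).1 hy)⟩
    · obtain ⟨x, hx⟩ : ∃ x, x ∈ (X : Set (Fin m → G)) := by
        obtain ⟨x, hx⟩ := X.2
        exact ⟨x, by rw [hx]; exact (WL m G).refl x⟩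
      obtain ⟨y, hy⟩ := hl x
      have hY : x ∘ σ ∈ (Y : Set (Fin m → G)) := by
        rw [hXY]
        exact ⟨x, hx, rfl⟩
      exact Setoid.eq_of_mem_classes (φ Y).2 ((key Y _ _ hY).2 (hy.comp σ))
        (isRainbow_WL.comp_mem _ (φ X).2 σ) ⟨y, (key X x y hx).2 hy, rfl⟩
    · obtain ⟨π, hπ⟩ := isWLBisim_wlRel.update _ _ ((key X₀ x y hx).1 hy)
      refine tupleCount_eq_of_equiv hπ fun x y i h => ?_
      obtain ⟨x', hx'⟩ : ∃ x, x ∈ (X i : Set (Fin m → G)) := by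
        obtain ⟨x, hx⟩ := (X i).2
        exact ⟨x, by rw [hx]; exact (WL m G).refl x⟩
      rw [mem_class_iff (X i).2 hx', key (X i) x' y hx', WL_iff]
      exact ⟨fun h' => h'.symm.trans h, fun h' => h.trans h'.symm⟩

end WeisfeilerLeman

/-! ### Projections: comparing the two families of bisimulations -/

section Projections

variable {G : Type u} [Group G] {K : Type v} [Group K] {m n : ℕ}

/-- The retraction of `Fin n` onto its initial segment `Fin m` that takes all other elements
to `0`. -/
def retractFin (hm : 0 < m) (n : ℕ) (i : Fin n) : Fin m :=
  if h : (i : ℕ) < m then ⟨i, h⟩ else ⟨0, hm⟩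

lemma retractFin_castLE (hm : 0 < m) (h : m ≤ n) (i : Fin m) :
    retractFin hm n (Fin.castLE h i) = i := by
  simp [retractFin]

lemma WLRel.retract (hm : 0 < m) {x : Fin n → G} {y : Fin n → K} (hxy : WLRel x y)
    (ι : Fin m → Fin n) :
    WLRel ((x ∘ ι) ∘ retractFin hm n) ((y ∘ ι) ∘ retractFin hm n) :=
  hxy.comp (ι ∘ retractFin hm n)

/-- The bisimulation between `G ^ m` and `K ^ m` that is the projection of the one between `G ^ n`
and `K ^ n`. -/
lemma isWLBisim_retract (hm : 0 < m) (h : m ≤ n) :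
    IsWLBisim fun (x : Fin m → G) (y : Fin m → K) =>
      WLRel (x ∘ retractFin hm n) (y ∘ retractFin hm n) :=
  isWLBisim_wlRel.of_retraction (retractFin_castLE hm h)

lemma WLEquivalent.of_le [Finite G] [Finite K] (hm : 0 < m) (h : m ≤ n) (hn : WLEquivalent n G K) :
    WLEquivalent m G K := by
  rw [wlEquivalent_iff] at hn ⊢
  obtain ⟨x, y, hxy⟩ := hn
  exact ⟨_, _, _, isWLBisim_retract hm h, hxy.retract hm (Fin.castLE h)⟩

/-- The three blocks of `m` coordinates each of a `3m`-tuple. -/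
def block (m : ℕ) (b : Fin 3) (i : Fin m) : Fin (3 * m) :=
  ⟨b * m + i, by
    have := i.2
    have := Nat.mul_le_mul_right m (show (b : ℕ) + 1 ≤ 3 by omega)
    rw [add_mul, one_mul] at this
    omega⟩

lemma block_inj {b c : Fin 3} {i j : Fin m} : block m b i = block m c j ↔ b = c ∧ i = j := by
  refine ⟨fun h => ?_, fun h => by rw [h.1, h.2]⟩
  have h' : (b : ℕ) * m + i = c * m + j := congrArg Fin.val h
  have hi := i.2
  have hj := j.2
  have hbc : (b : ℕ) = c := by
    rcases lt_trichotomy (b : ℕ) c with hlt | heq | hlt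
    · have := Nat.mul_le_mul_right m (show (b : ℕ) + 1 ≤ c from hlt)
      rw [add_mul, one_mul] at this
      omega
    · exact heq
    · have := Nat.mul_le_mul_right m (show (c : ℕ) + 1 ≤ b from hlt)
      rw [add_mul, one_mul] at this
      omega
  refine ⟨Fin.ext hbc, Fin.ext ?_⟩
  rw [hbc] at h'
  omega

lemma block_zero (h : m ≤ 3 * m) : block m 0 = Fin.castLE h := by
  ext i
  simp [block]

lemma retract_comp_block {M : Type*} (hm : 0 < m) (z : Fin m → M) :
    (z ∘ retractFin hm (3 * m)) ∘ block m 0 = z := by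
  have hle : m ≤ 3 * m := by omega
  ext i
  simp [block_zero hle, retractFin_castLE hm hle]

/-- The projection to `m` coordinates of the largest bisimulation between `3m`-tuples is a Schur
bisimulation: a factorization `z = x * y` is encoded by the `3m`-tuple `(z, y, x)`. -/
theorem isPowerBisim_retract (hm : 0 < m) :
    IsPowerBisim fun (x : Fin m → G) (y : Fin m → K) =>
      WLRel (x ∘ retractFin hm (3 * m)) (y ∘ retractFin hm (3 * m)) := by
  have hle : m ≤ 3 * m := by omega
  have hinj : ∀ b, Function.Injective (block m b) := fun b i j h => (block_inj.1 h).2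
  have h01 : ∀ i j, block m 0 i ≠ block m 1 j := fun i j h => by simpa using (block_inj.1 h).1
  have h02 : ∀ i j, block m 0 i ≠ block m 2 j := fun i j h => by simpa using (block_inj.1 h).1
  have h12 : ∀ i j, block m 1 i ≠ block m 2 j := fun i j h => by simpa using (block_inj.1 h).1
  -- Changing the second block bijectively and then the third one.
  have main : ∀ (z : Fin m → G) (z' : Fin m → K),
      WLRel (z ∘ retractFin hm (3 * m)) (z' ∘ retractFin hm (3 * m)) →
      ∃ π : (Fin m → G) ≃ (Fin m → K), ∀ x, ∃ (p : Fin (3 * m) → G) (q : Fin (3 * m) → K),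
        WLRel p q ∧ p ∘ block m 0 = z ∧ p ∘ block m 1 = x ∧ p ∘ block m 2 = z * x⁻¹ ∧
        q ∘ block m 0 = z' ∧ q ∘ block m 1 = π x ∧ q ∘ block m 2 = z' * (π x)⁻¹ := by
    intro z z' hz
    obtain ⟨π, hπ⟩ := isWLBisim_wlRel.exists_equiv m (block m 1) (hinj 1) hz
    refine ⟨π, fun x => ?_⟩
    obtain ⟨p, q, h1, h2, h3, h4⟩ := hπ x
    obtain ⟨p', q', h5, h6, h7, h8⟩ : ∃ p' q', WLRel p' q' ∧ p' ∘ block m 2 = z * x⁻¹ ∧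
        (∀ i, i ∉ Set.range (block m 2) → p' i = p i) ∧
        ∀ i, i ∉ Set.range (block m 2) → q' i = q i := by
      obtain ⟨ρ, hρ⟩ := isWLBisim_wlRel.exists_equiv m (block m 2) (hinj 2) h1
      obtain ⟨p', q', h5, h6, -, h8⟩ := hρ (z * x⁻¹)
      exact ⟨p', q', h5, h6, fun i hi => (h8 i hi).1, fun i hi => (h8 i hi).2⟩
    have r0 : ∀ i, block m 0 i ∉ Set.range (block m 2) := fun i ⟨j, hj⟩ => h02 _ _ hj.symm
    have r1 : ∀ i, block m 1 i ∉ Set.range (block m 2) := fun i ⟨j, hj⟩ => h12 _ _ hj.symm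
    have r01 : ∀ i, block m 0 i ∉ Set.range (block m 1) := fun i ⟨j, hj⟩ => h01 _ _ hj.symm
    have e0 : p' ∘ block m 0 = z := by
      rw [← retract_comp_block hm z]
      ext i
      exact (h7 _ (r0 i)).trans (h4 _ (r01 i)).1
    have e1 : p' ∘ block m 1 = x := by
      rw [← h2]
      ext i
      exact h7 _ (r1 i)
    have f0 : q' ∘ block m 0 = z' := by
      rw [← retract_comp_block hm z']
      ext i
      exact (h8 _ (r0 i)).trans (h4 _ (r01 i)).2
    have f1 : q' ∘ block m 1 = π x := by
      rw [← h3]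
      ext i
      exact h8 _ (r1 i)
    refine ⟨p', q', h5, e0, e1, h6, f0, f1, ?_⟩
    ext i
    have h9 := isWLBisim_wlRel.mul_iff _ _ h5 (block m 2 i) (block m 1 i) (block m 0 i)
    have g6 := congrFun h6 i
    have g0 := congrFun e0 i
    have g1 := congrFun e1 i
    have k0 := congrFun f0 i
    have k1 := congrFun f1 i
    simp only [Function.comp_apply] at g6 g0 g1 k0 k1 ⊢
    rw [g6, g1, g0, k0, k1] at h9
    rw [Pi.mul_apply, Pi.inv_apply, eq_mul_inv_iff_mul_eq]
    exact h9.1 (by simp)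
  have one_iff : ∀ x y, WLRel (x ∘ retractFin hm (3 * m)) (y ∘ retractFin hm (3 * m)) →
      ∀ i : Fin m, (x i : G) = 1 ↔ (y i : K) = 1 := by
    intro x y h i
    have h1 := (isWLBisim_retract hm hle).mul_iff x y h i i i
    simpa using h1
  refine ⟨⟨fun z z' hz => ?_, fun z z' hz => ?_, fun z z' hz => ?_⟩, one_iff, fun x y h => ?_⟩
  · obtain ⟨π, hπ⟩ := main z z' hz
    refine ⟨π, fun x => ?_⟩
    obtain ⟨p, q, hpq, -, p1, p2, -, q1, q2⟩ := hπ x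
    have h1 := hpq.retract hm (block m 1)
    have h2 := hpq.retract hm (block m 2)
    rw [p1, q1] at h1
    rw [p2, q2] at h2
    exact ⟨h1, h2⟩
  · -- The factorization `z = z² * z⁻¹` is distinguished from others by the relation `z * z = z²`.
    obtain ⟨π, hπ⟩ := main z z' hz
    obtain ⟨p, q, hpq, p0, p1, p2, q0, q1, q2⟩ := hπ z⁻¹
    have h1 := hpq.retract hm (block m 1)
    have h2 : π z⁻¹ = z'⁻¹ := by
      ext i
      have h3 := isWLBisim_wlRel.mul_iff _ _ hpq (block m 0 i) (block m 0 i) (block m 2 i)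
      have g0 := congrFun p0 i
      have g2 := congrFun p2 i
      have k0 := congrFun q0 i
      have k2 := congrFun q2 i
      simp only [Function.comp_apply] at g0 g2 k0 k2
      rw [g0, g2, k0, k2] at h3
      have h4 := h3.1 (by simp)
      rw [Pi.mul_apply, mul_right_inj] at h4
      rw [Pi.inv_apply, h4, Pi.inv_apply, inv_inv]
    rw [p1, q1, h2] at h1
    exact h1
  · rw [funext_iff, funext_iff]
    exact forall_congr' (one_iff _ _ hz)
  · have h1 := (isWLBisim_retract hm hle).eq_iff x y h
    constructor
    · rintro ⟨g, hg⟩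
      exact ⟨y ⟨0, hm⟩, fun i => (h1 _ _).1 (by rw [hg, hg])⟩
    · rintro ⟨g, hg⟩
      exact ⟨x ⟨0, hm⟩, fun i => (h1 _ _).2 (by rw [hg, hg])⟩

/-- A tuple of length `m`, extended by the identity element, is a tuple of length `m + 1`. -/
def snocOne (x : Fin m → G) : Fin (m + 1) → G := Fin.snoc x 1

lemma snocOne_castSucc (x : Fin m → G) (i : Fin m) : snocOne x i.castSucc = x i := by
  simp [snocOne]

lemma snocOne_last (x : Fin m → G) : snocOne x (Fin.last m) = 1 := by simp [snocOne]

lemma snocOne_eq_iff {x : Fin m → G} {u : Fin (m + 1) → G} :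
    u = snocOne x ↔ u (Fin.last m) = 1 ∧ ∀ i : Fin m, u i.castSucc = x i := by
  constructor
  · rintro rfl
    exact ⟨snocOne_last x, snocOne_castSucc x⟩
  · rintro ⟨h1, h2⟩
    ext i
    refine Fin.lastCases ?_ (fun i => ?_) i
    · rw [h1, snocOne_last]
    · rw [h2, snocOne_castSucc]

lemma snocOne_one : snocOne (1 : Fin m → G) = 1 :=
  (snocOne_eq_iff.2 ⟨rfl, fun _ => rfl⟩ : (1 : Fin (m + 1) → G) = snocOne (1 : Fin m → G)).symm

lemma PowerRel.snocOne_init {u : Fin (m + 1) → G} {v : Fin (m + 1) → K} (h : PowerRel u v)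
    {x : Fin m → G} {y : Fin m → K} (hx : ∀ i : Fin m, u i.castSucc = x i)
    (hy : ∀ i : Fin m, v i.castSucc = y i) : PowerRel (snocOne x) (snocOne y) := by
  have h1 := h.update_one (Fin.last m)
  have h2 : Function.update u (Fin.last m) 1 = snocOne x := snocOne_eq_iff.2
    ⟨Function.update_self _ _ _, fun i => by
      rw [Function.update_of_ne (Fin.castSucc_lt_last i).ne, hx]⟩
  have h3 : Function.update v (Fin.last m) 1 = snocOne y := snocOne_eq_iff.2
    ⟨Function.update_self _ _ _, fun i => by
      rw [Function.update_of_ne (Fin.castSucc_lt_last i).ne, hy]⟩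
  rwa [h2, h3] at h1

/-- The spare coordinate plays the role of the pebble that is moved by the Weisfeiler-Leman
algorithm. -/
theorem isWLBisim_snocOne :
    IsWLBisim fun (x : Fin m → G) (y : Fin m → K) => PowerRel (snocOne x) (snocOne y) where
  eq_iff x y h i j := by
    simpa only [snocOne_castSucc] using h.apply_eq_apply_iff i.castSucc j.castSucc
  mul_iff x y h i j k := by
    have h1 : ∀ i, x i = 1 ↔ y i = 1 := fun i => by
      simpa only [snocOne_castSucc] using h.eq_one i.castSucc
    rcases eq_or_ne j k with rfl | hjk
    · simpa using h1 i
    rcases eq_or_ne i k with rfl | hik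
    · simpa using h1 j
    rcases eq_or_ne i j with rfl | hij
    · -- A second copy of the coordinate `i` is kept in the spare coordinate.
      have hne : ∀ i : Fin m, i.castSucc ≠ Fin.last m := fun i => (Fin.castSucc_lt_last i).ne
      have h2 := (h.update_apply i.castSucc (Fin.last m)).mul_eq_iff (i := i.castSucc)
        (j := Fin.last m) (k := k.castSucc) (hne i) (by simpa using hik)
      simpa [hne, snocOne_castSucc] using h2
    · have h2 := h.mul_eq_iff (i := i.castSucc) (j := j.castSucc) (k := k.castSucc)
        (by simpa using hij) (by simpa using hik)
      simpa only [snocOne_castSucc] using h2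
  comp x y h σ := by
    refine (h.comp fun i => Fin.lastCases (Fin.last m) (fun i => (σ i).castSucc) i).snocOne_init
      (fun i => ?_) fun i => ?_
    · simp [snocOne_castSucc]
    · simp [snocOne_castSucc]
  update x y h := by
    classical
    obtain ⟨π, hπ⟩ := isPowerBisim_powerRel.mul _ _ h
    -- A factor of `(x, 1)` that agrees with it up to the last coordinate has the form `(x, α)`.
    have hr : ∀ α, π (Fin.snoc x α) = Fin.snoc y (π (Fin.snoc x α) (Fin.last m)) := by
      intro α
      ext i
      refine Fin.lastCases ?_ (fun i => ?_) i
      · simp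
      · rw [Fin.snoc_castSucc, (hπ _).2.factor_apply_eq (by simp [snocOne_castSucc]),
          snocOne_castSucc]
    have hl : ∀ β, π.symm (Fin.snoc y β) = Fin.snoc x (π.symm (Fin.snoc y β) (Fin.last m)) := by
      intro β
      have h1 := (hπ (π.symm (Fin.snoc y β))).2.symm
      rw [π.apply_symm_apply] at h1
      ext i
      refine Fin.lastCases ?_ (fun i => ?_) i
      · simp
      · rw [Fin.snoc_castSucc, h1.factor_apply_eq (by simp [snocOne_castSucc]), snocOne_castSucc]
    refine ⟨⟨fun α => π (Fin.snoc x α) (Fin.last m), fun β => π.symm (Fin.snoc y β) (Fin.last m),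
      fun α => ?_, fun β => ?_⟩, fun i α => ?_⟩
    · simp only
      rw [← hr, π.symm_apply_apply, Fin.snoc_last]
    · simp only
      rw [← hl, π.apply_symm_apply, Fin.snoc_last]
    · have h1 := (hπ (Fin.snoc x α)).1
      rw [hr] at h1
      refine (h1.update_apply (Fin.last m) i.castSucc).snocOne_init (fun j => ?_) fun j => ?_
      · rcases eq_or_ne j i with rfl | hj
        · simp
        · simp [hj]
      · rcases eq_or_ne j i with rfl | hj
        · simp
        · simp [hj]

/-- The partition of `G ^ m` by the projections of the classes of `WL_n(G)`. -/
lemma projClasses_WL [Finite G] (hm : 0 < m) (h : m ≤ n) : projClasses h (WL n G) =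
    (Setoid.comap (fun x : Fin m → G => x ∘ retractFin hm n) (wlSetoid G n)).classes := by
  have key : ∀ u : Fin n → G, prFirst h '' {x | WL n G x u} =
      {x | WLRel (x ∘ retractFin hm n) (prFirst h u ∘ retractFin hm n)} := by
    intro u
    ext x
    constructor
    · rintro ⟨w, hw, rfl⟩
      exact (WL_iff.1 hw).retract hm (Fin.castLE h)
    · intro hx
      obtain ⟨w, h1, h2⟩ := isWLBisim_wlRel.exists_right (WLRel.symm hx) u
      refine ⟨w, WL_iff.2 h1.symm, ?_⟩
      ext i
      have h3 := h2 (Fin.castLE h i) (by simp [retractFin_castLE hm h, prFirst])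
      rw [Function.comp_apply, retractFin_castLE hm h] at h3
      exact h3.symm
  ext Y
  constructor
  · rintro ⟨_, ⟨u, rfl⟩, rfl⟩
    exact ⟨prFirst h u, key u⟩
  · rintro ⟨y, rfl⟩
    refine ⟨_, ⟨y ∘ retractFin hm n, rfl⟩, ?_⟩
    rw [key]
    have : prFirst h (y ∘ retractFin hm n) = y := by
      ext i
      simp [prFirst, retractFin_castLE hm h]
    rw [this]
    rfl

/-- The partition of `G ^ m` by the projections of the basic sets of `𝔄_{m + 1}(G)`. -/
lemma projClasses_schurRingPower [Finite G] (h : m ≤ m + 1) :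
    projClasses h (schurRingPower G (m + 1)).rel =
      (Setoid.comap (fun x : Fin m → G => snocOne x) (schurRingPower G (m + 1)).rel).classes := by
  have key : ∀ u : Fin (m + 1) → G, prFirst h '' {x | (schurRingPower G (m + 1)).rel x u} =
      {x | (schurRingPower G (m + 1)).rel (snocOne x) (snocOne (prFirst h u))} := by
    intro u
    ext x
    constructor
    · rintro ⟨w, hw, rfl⟩
      exact schurRingPower_rel_iff.2
        ((schurRingPower_rel_iff.1 hw).snocOne_init (fun _ => rfl) fun _ => rfl)
    · intro hx
      obtain ⟨w, h1, h2⟩ := (schurRingPower_rel_iff.1 hx).symm.exists_factor u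
      refine ⟨w, schurRingPower_rel_iff.2 h1.symm, ?_⟩
      ext i
      have h3 := h2.factor_apply_eq (i := i.castSucc) (snocOne_castSucc (prFirst h u) i).symm
      rw [snocOne_castSucc] at h3
      exact h3
  ext Y
  constructor
  · rintro ⟨_, ⟨u, rfl⟩, rfl⟩
    exact ⟨prFirst h u, key u⟩
  · rintro ⟨y, rfl⟩
    refine ⟨_, ⟨snocOne y, rfl⟩, ?_⟩
    rw [key]
    have : prFirst h (snocOne y) = y := funext fun i => snocOne_castSucc y i
    rw [this]
    rfl

theorem projClasses_WL_isAtLeastAsFine [Finite G] (hm : 0 < m) (h : m ≤ 3 * m) :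
    IsAtLeastAsFine (projClasses h (WL (3 * m) G)) (schurRingPower G m).basicSets := by
  rw [projClasses_WL hm h]
  exact isAtLeastAsFine_classes fun x y hxy =>
    schurRingPower_rel_iff.2 ⟨_, isPowerBisim_retract hm, hxy⟩

theorem projClasses_schurRingPower_isAtLeastAsFine [Finite G] (h : m ≤ m + 1) :
    IsAtLeastAsFine (projClasses h (schurRingPower G (m + 1)).rel) (WL m G).classes := by
  rw [projClasses_schurRingPower h]
  exact isAtLeastAsFine_classes fun x y hxy =>
    WL_iff.2 ⟨_, isWLBisim_snocOne, schurRingPower_rel_iff.1 hxy⟩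

end Projections

/-! ### Coordinates on a group with an S-ring algebraically isomorphic to `𝔄_m(G)` -/

section Coordinates

variable {G : Type u} [Group G] {H : Type v} [Group H] {m : ℕ}

lemma mem_diag_iff {M : Type*} (hm : 0 < m) {x : Fin m → M} : x ∈ diag M m ↔ ∀ i j, x i = x j :=
  ⟨fun ⟨_, hg⟩ i j => by rw [hg, hg], fun h => ⟨x ⟨0, hm⟩, fun _ => h _ _⟩⟩

/-- A bitotal Schur bisimulation between `G ^ m` and a group `H` under which the points related to
the same element of `H` lie in the same basic set of `𝔄_m(G)`. It carries the unions of basic sets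
of `𝔄_m(G)` over to `H`. -/
structure IsTransfer (R : (Fin m → G) → H → Prop) : Prop extends IsSchurBisim R where
  exists_right : ∀ x, ∃ h, R x h
  exists_left : ∀ h, ∃ x, R x h
  powerRel : ∀ x x' h, R x h → R x' h → PowerRel x x'

namespace IsTransfer

variable {R : (Fin m → G) → H → Prop}

lemma rel_one (hR : IsTransfer R) : R 1 1 := by
  obtain ⟨h, hh⟩ := hR.exists_right 1
  rwa [(hR.one _ _ hh).1 rfl] at hh

/-- The subgroup of `H` that corresponds to a subgroup of `G ^ m` which is a union of basic sets. -/
def imageSubgroup (hR : IsTransfer R) (N : Subgroup (Fin m → G))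
    (hN : ∀ x y : Fin m → G, PowerRel x y → x ∈ N → y ∈ N) : Subgroup H where
  carrier := {h | ∃ z, R z h ∧ z ∈ N}
  one_mem' := ⟨1, hR.rel_one, N.one_mem⟩
  inv_mem' := fun ⟨z, hz, hzN⟩ => ⟨z⁻¹, hR.inv _ _ hz, N.inv_mem hzN⟩
  mul_mem' := by
    rintro a b ⟨x, hx, hxN⟩ ⟨y, hy, hyN⟩
    obtain ⟨z, hz⟩ := hR.exists_left (a * b)
    obtain ⟨π, hπ⟩ := hR.mul _ _ hz
    obtain ⟨h1, h2⟩ := hπ (π.symm b)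
    rw [π.apply_symm_apply] at h1 h2
    rw [mul_inv_cancel_right] at h2
    have h3 := N.mul_mem (hN _ _ (hR.powerRel _ _ _ hx h2) hxN)
      (hN _ _ (hR.powerRel _ _ _ hy h1) hyN)
    exact ⟨z, hz, by simpa using h3⟩

lemma mem_imageSubgroup (hR : IsTransfer R) {N : Subgroup (Fin m → G)}
    {hN : ∀ x y : Fin m → G, PowerRel x y → x ∈ N → y ∈ N} {z : Fin m → G} {h : H} (hz : R z h) :
    h ∈ hR.imageSubgroup N hN ↔ z ∈ N :=
  ⟨fun ⟨_, hz', hzN⟩ => hN _ _ (hR.powerRel _ _ _ hz' hz) hzN, fun hzN => ⟨z, hz, hzN⟩⟩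

/-- The subgroup of `H` that corresponds to `{z | z i = 1}`. -/
def coordKer (hR : IsTransfer R) (i : Fin m) : Subgroup H :=
  hR.imageSubgroup (Pi.evalMonoidHom (fun _ => G) i).ker fun _ _ h hx => (h.eq_one i).1 hx

/-- The subgroup of `H` that corresponds to `{z | z i = z j}`. -/
def coordEq (hR : IsTransfer R) (i j : Fin m) : Subgroup H :=
  hR.imageSubgroup ((Pi.evalMonoidHom (fun _ => G) i).eqLocus (Pi.evalMonoidHom (fun _ => G) j))
    fun _ _ h hx => h.apply_eq_apply (i := i) (j := j) hx

lemma mem_coordKer (hR : IsTransfer R) {i : Fin m} {z : Fin m → G} {h : H} (hz : R z h) :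
    h ∈ hR.coordKer i ↔ z i = 1 := hR.mem_imageSubgroup hz

lemma mem_coordEq (hR : IsTransfer R) {i j : Fin m} {z : Fin m → G} {h : H} (hz : R z h) :
    h ∈ hR.coordEq i j ↔ z i = z j := hR.mem_imageSubgroup hz

/-- The subset of `H` that corresponds to the diagonal. -/
def diagImage (hR : IsTransfer R) : Set H := {h | ∀ i j, h ∈ hR.coordEq i j}

lemma eq_one_of_mem_coordKer (hR : IsTransfer R) {h : H} (hh : ∀ i, h ∈ hR.coordKer i) : h = 1 := by
  obtain ⟨z, hz⟩ := hR.exists_left h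
  exact (hR.one _ _ hz).1 (funext fun i => (hR.mem_coordKer hz).1 (hh i))

lemma mem_coordEq_of_mem_coordKer (hR : IsTransfer R) {i j : Fin m} {h : H}
    (hi : h ∈ hR.coordKer i) (hj : h ∈ hR.coordKer j) : h ∈ hR.coordEq i j := by
  obtain ⟨z, hz⟩ := hR.exists_left h
  rw [hR.mem_coordEq hz, (hR.mem_coordKer hz).1 hi, (hR.mem_coordKer hz).1 hj]

lemma mem_coordKer_of_mem_coordEq (hR : IsTransfer R) {i j : Fin m} {h : H}
    (hij : h ∈ hR.coordEq i j) (hi : h ∈ hR.coordKer i) : h ∈ hR.coordKer j := by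
  obtain ⟨z, hz⟩ := hR.exists_left h
  rw [hR.mem_coordKer hz, ← (hR.mem_coordEq hz).1 hij, (hR.mem_coordKer hz).1 hi]

lemma coordEq_trans (hR : IsTransfer R) {i j k : Fin m} {h : H}
    (hij : h ∈ hR.coordEq i j) (hjk : h ∈ hR.coordEq j k) : h ∈ hR.coordEq i k := by
  obtain ⟨z, hz⟩ := hR.exists_left h
  rw [hR.mem_coordEq hz, (hR.mem_coordEq hz).1 hij, (hR.mem_coordEq hz).1 hjk]

lemma coordEq_symm (hR : IsTransfer R) {i j : Fin m} {h : H}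
    (hij : h ∈ hR.coordEq i j) : h ∈ hR.coordEq j i := by
  obtain ⟨z, hz⟩ := hR.exists_left h
  rw [hR.mem_coordEq hz, (hR.mem_coordEq hz).1 hij]

/-- The group `H` is the product of the `i`th coordinate subgroup and the image of the diagonal. -/
lemma exists_mem_diagImage (hR : IsTransfer R) (h : H) (i : Fin m) :
    ∃ d ∈ hR.diagImage, h * d⁻¹ ∈ hR.coordKer i := by
  obtain ⟨z, hz⟩ := hR.exists_left h
  obtain ⟨π, hπ⟩ := hR.mul _ _ hz
  obtain ⟨h1, h2⟩ := hπ fun _ => z i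
  exact ⟨_, fun j k => (hR.mem_coordEq h1).2 rfl, (hR.mem_coordKer h2).2 (by simp)⟩

lemma eq_of_mem_diagImage (hR : IsTransfer R) {d d' : H} (hd : d ∈ hR.diagImage)
    (hd' : d' ∈ hR.diagImage) {i : Fin m} (h : d * d'⁻¹ ∈ hR.coordKer i) : d = d' := by
  refine mul_inv_eq_one.1 (hR.eq_one_of_mem_coordKer fun j => ?_)
  exact hR.mem_coordKer_of_mem_coordEq ((hR.coordEq i j).mul_mem (hd i j)
    ((hR.coordEq i j).inv_mem (hd' i j))) h

/-- Some element of `H` has the same `i`th coordinate as `x`, and the same ratio of the coordinates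
`i` and `j` as `v`. -/
lemma exists_mem_coordKer_mem_coordEq (hR : IsTransfer R) (i j : Fin m) (x v : H) :
    ∃ w : H, w * x⁻¹ ∈ hR.coordKer i ∧ w * v⁻¹ ∈ hR.coordEq i j := by
  obtain ⟨z, hz⟩ := hR.exists_left (x * v⁻¹)
  obtain ⟨π, hπ⟩ := hR.mul _ _ hz
  obtain ⟨h1, h2⟩ := hπ fun _ => z i
  refine ⟨π (fun _ => z i) * v, ?_, ?_⟩
  · have h3 := (hR.coordKer i).inv_mem ((hR.mem_coordKer (i := i) h2).2 (by simp))
    simpa [mul_assoc] using h3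
  · rw [mul_inv_cancel_right]
    exact (hR.mem_coordEq h1).2 rfl

/-- The `i`th coordinate of an element of `H`: its component in the image of the diagonal. -/
noncomputable def coord (hR : IsTransfer R) (h : H) (i : Fin m) : hR.diagImage :=
  ⟨_, (hR.exists_mem_diagImage h i).choose_spec.1⟩

lemma mul_coord_inv_mem (hR : IsTransfer R) (h : H) (i : Fin m) :
    h * (hR.coord h i : H)⁻¹ ∈ hR.coordKer i := (hR.exists_mem_diagImage h i).choose_spec.2

lemma coord_eq_iff (hR : IsTransfer R) {a b : H} {i : Fin m} :
    hR.coord a i = hR.coord b i ↔ a * b⁻¹ ∈ hR.coordKer i := by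
  have ha := hR.mul_coord_inv_mem a i
  have hb := hR.mul_coord_inv_mem b i
  constructor
  · intro h
    rw [h] at ha
    simpa using (hR.coordKer i).mul_mem ha ((hR.coordKer i).inv_mem hb)
  · intro h
    refine Subtype.ext (hR.eq_of_mem_diagImage (hR.coord a i).2 (hR.coord b i).2 (i := i) ?_)
    have := (hR.coordKer i).mul_mem ((hR.coordKer i).mul_mem ((hR.coordKer i).inv_mem ha) h) hb
    simpa [mul_assoc] using this

lemma coord_of_mem (hR : IsTransfer R) {d : H} (hd : d ∈ hR.diagImage) (i : Fin m) :
    hR.coord d i = ⟨d, hd⟩ := by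
  refine Subtype.ext (hR.eq_of_mem_diagImage (hR.coord d i).2 hd (i := i) ?_)
  have := (hR.coordKer i).inv_mem (hR.mul_coord_inv_mem d i)
  simpa using this

/-- The closure of `R` under the right translations of `K ^ m` in place of those of `H` is a
bisimulation between `G ^ m` and `K ^ m`: the images of the generators are invariant under them. -/
lemma isPowerBisim_of_coordinates (hR : IsTransfer R) (hm : 0 < m) {K : Type w} [Group K]
    {F : (Fin m → K) ≃ H} (hker : ∀ i u v, F u * (F v)⁻¹ ∈ hR.coordKer i ↔ u i = v i)
    (heq : ∀ i j u v, F u * (F v)⁻¹ ∈ hR.coordEq i j ↔ u i * (v i)⁻¹ = u j * (v j)⁻¹) :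
    IsPowerBisim fun z y => ∃ u v, u * v⁻¹ = y ∧ R z (F u * (F v)⁻¹) := by
  refine ⟨⟨?_, ?_, ?_⟩, ?_, ?_⟩
  · rintro z _ ⟨u, v, rfl, h⟩
    obtain ⟨π, hπ⟩ := hR.mul _ _ h
    refine ⟨π.trans ((Equiv.mulRight (F v)).trans (F.symm.trans (Equiv.mulRight v⁻¹))),
      fun x => ⟨⟨F.symm (π x * F v), v, rfl, ?_⟩, ⟨u, F.symm (π x * F v), ?_, ?_⟩⟩⟩
    · simpa using (hπ x).1
    · simp
    · simpa [mul_assoc] using (hπ x).2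
  · rintro z _ ⟨u, v, rfl, h⟩
    exact ⟨v, u, by simp, by simpa using hR.inv _ _ h⟩
  · rintro z _ ⟨u, v, rfl, h⟩
    rw [hR.one _ _ h, mul_inv_eq_one, mul_inv_eq_one, F.injective.eq_iff]
  · rintro z _ ⟨u, v, rfl, h⟩ i
    rw [← hR.mem_coordKer h, hker, Pi.mul_apply, Pi.inv_apply, mul_inv_eq_one]
  · rintro z _ ⟨u, v, rfl, h⟩
    rw [mem_diag_iff hm, mem_diag_iff hm]
    refine forall₂_congr fun i j => ?_
    rw [← hR.mem_coordEq h, heq]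
    rfl

variable [Finite G] [Finite H]

lemma coord_bijective (hR : IsTransfer R) (hm : 0 < m) : Function.Bijective hR.coord := by
  have := Fintype.ofFinite H
  have := Fintype.ofFinite G
  have := Fintype.ofFinite hR.diagImage
  rw [Fintype.bijective_iff_injective_and_card]
  constructor
  · intro a b hab
    exact mul_inv_eq_one.1 (hR.eq_one_of_mem_coordKer fun i => hR.coord_eq_iff.1 (congrFun hab i))
  · obtain ⟨π, hπ⟩ := hR.mul _ _ hR.rel_one
    replace hπ := fun x => (hπ x).1
    have e : G ≃ hR.diagImage := by
      refine Equiv.ofBijective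
        (fun g => ⟨π fun _ => g, fun i j => (hR.mem_coordEq (hπ _)).2 rfl⟩) ⟨fun g g' h => ?_, ?_⟩
      · exact congrFun (π.injective (congrArg Subtype.val h)) ⟨0, hm⟩
      · rintro ⟨d, hd⟩
        obtain ⟨z, rfl⟩ := π.surjective d
        refine ⟨z ⟨0, hm⟩, Subtype.ext (congrArg π (funext fun i => ?_))⟩
        exact (hR.mem_coordEq (hπ z)).1 (hd ⟨0, hm⟩ i)
    rw [← Fintype.card_congr π, Fintype.card_fun, Fintype.card_fun, Fintype.card_congr e]

/-- A group that carries an algebraic image of `𝔄_m(G)`, where `m ≥ 3`, has a system of coordinates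
in some group `K` for which the images of the generators of `𝔄_m(G)` have their usual form. The
bijection `F` need not be a homomorphism. -/
theorem exists_coordinates (hR : IsTransfer R) (hm : 3 ≤ m) :
    ∃ (K : Type v) (_ : Group K) (F : (Fin m → K) ≃ H), F 1 = 1 ∧
      (∀ i u v, F u * (F v)⁻¹ ∈ hR.coordKer i ↔ u i = v i) ∧
      ∀ i j u v, F u * (F v)⁻¹ ∈ hR.coordEq i j ↔ u i * (v i)⁻¹ = u j * (v j)⁻¹ := by
  have hone : (1 : H) ∈ hR.diagImage := fun i j => (hR.coordEq i j).one_mem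
  let C : H ≃ (Fin m → hR.diagImage) := Equiv.ofBijective hR.coord (hR.coord_bijective (by omega))
  have hC : ∀ u i, hR.coord (C.symm u) i = u i := fun u i => congrFun (C.apply_symm_apply u) i
  have hker : ∀ i u v, C.symm u * (C.symm v)⁻¹ ∈ hR.coordKer i ↔ u i = v i := fun i u v => by
    rw [← hR.coord_eq_iff, hC, hC]
  let E : Fin m → Fin m → Setoid (Fin m → hR.diagImage) := fun i j =>
    { r := fun u v => C.symm u * (C.symm v)⁻¹ ∈ hR.coordEq i j
      iseqv :=
        { refl := fun u => by simp [(hR.coordEq i j).one_mem]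
          symm := fun {u v} h => by simpa using (hR.coordEq i j).inv_mem h
          trans := fun {u v w} h h' => by simpa using (hR.coordEq i j).mul_mem h h' } }
  have hE : IsRatioSystem E := by
    refine ⟨fun i j u v hi hj => ?_, fun i j u v h hi => ?_, fun i j k u v h h' => ?_,
      fun i j u v h => ?_, fun i j u v hu hv => ?_, fun i j hij v x => ?_⟩
    · exact hR.mem_coordEq_of_mem_coordKer ((hker _ _ _).2 hi) ((hker _ _ _).2 hj)
    · exact (hker _ _ _).1 (hR.mem_coordKer_of_mem_coordEq h ((hker _ _ _).2 hi))
    · exact hR.coordEq_trans h h'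
    · exact hR.coordEq_symm h
    · have key : ∀ u : Fin m → hR.diagImage, u i = u j → C.symm u ∈ hR.coordEq i j := by
        intro u hu
        have h1 := hR.mul_coord_inv_mem (C.symm u) i
        have h2 := hR.mul_coord_inv_mem (C.symm u) j
        rw [hC] at h1 h2
        rw [← hu] at h2
        have h3 := (hR.coordEq i j).mul_mem (hR.mem_coordEq_of_mem_coordKer h1 h2) ((u i).2 i j)
        simpa using h3
      exact (hR.coordEq i j).mul_mem (key u hu) ((hR.coordEq i j).inv_mem (key v hv))
    · obtain ⟨w, h1, h2⟩ := hR.exists_mem_coordKer_mem_coordEq i j (x : H) (C.symm v)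
      refine ⟨C w, ?_, ?_⟩
      · have h3 := hR.coord_eq_iff.2 h1
        rw [hR.coord_of_mem x.2] at h3
        exact h3
      · change C.symm (C w) * (C.symm v)⁻¹ ∈ hR.coordEq i j
        rwa [C.symm_apply_apply]
  obtain ⟨K, hK, e, he1, he⟩ := hE.exists_group hm ⟨1, hone⟩
  refine ⟨K, hK, (Equiv.arrowCongr (Equiv.refl _) e).trans C.symm, ?_, fun i u v => ?_,
    fun i j u v => ?_⟩
  · change C.symm (fun i => e 1) = 1
    rw [he1, C.symm_apply_eq]
    exact funext fun i => (hR.coord_of_mem hone i).symm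
  · exact (hker i _ _).trans e.injective.eq_iff
  · rcases eq_or_ne i j with rfl | hij
    · obtain ⟨z, hz⟩ := hR.exists_left (C.symm (fun i => e (u i)) * (C.symm fun i => e (v i))⁻¹)
      exact iff_of_true ((hR.mem_coordEq hz).2 rfl) rfl
    · exact he i j hij u v

end IsTransfer

end Coordinates

/-! ### Separability and the Weisfeiler-Leman dimension -/

section Dimension

variable {G : Type u} [Group G] [Finite G] {m : ℕ}

/-- An algebraic isomorphism of `𝔄_{m + 1}(G)` is induced by an isomorphism as soon as `G` is
identified by the `m`-dimensional Weisfeiler-Leman algorithm. -/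
theorem algIsosInduced_succ (hm : 2 ≤ m)
    (hG : ∀ (K : Type u) [Group K] [Finite K], WLEquivalent m G K → Nonempty (G ≃* K)) :
    AlgIsosInduced G (m + 1) := by
  intro H _ _ B φ hφ
  have hR : IsTransfer (SchurRing.Corresponds φ) :=
    { hφ.isSchurBisim with
      exists_right := hφ.exists_right
      exists_left := hφ.exists_left
      powerRel := fun x x' h hx hx' =>
        schurRingPower_rel_iff.1 ((hx.rel_iff hx').2 (B.rel.refl h)) }
  obtain ⟨K, _, F, hF1, hker, heq⟩ := hR.exists_coordinates (by omega)
  have hfin : Finite K := by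
    have : Finite (Fin (m + 1) → K) := Finite.of_equiv _ F.symm
    exact Finite.of_injective (fun (a : K) (_ : Fin (m + 1)) => a) fun a b h => congrFun h 0
  have hS := hR.isPowerBisim_of_coordinates (by omega) hker heq
  obtain ⟨e⟩ : Nonempty (G ≃* K) := by
    refine hG K (wlEquivalent_iff.2 ⟨1, 1, _, isWLBisim_snocOne, _, hS, 1, 1, ?_, ?_⟩)
    · rw [snocOne_one, inv_one, mul_one]
    · rw [snocOne_one, mul_inv_cancel]
      exact hR.rel_one
  let f : (Fin (m + 1) → G) ≃ H := (Equiv.arrowCongr (Equiv.refl _) e.toEquiv).trans F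
  have hf1 : f 1 = 1 := by
    rw [← hF1]
    exact congrArg F (funext fun _ => map_one e)
  -- By the maximality of `PowerRel`, the map `f` is compatible with `φ`.
  have hf : ∀ x y, SchurRing.Corresponds φ (x * y⁻¹) (f x * (f y)⁻¹) := by
    intro x y
    obtain ⟨z, hz⟩ := hφ.exists_left (f x * (f y)⁻¹)
    have h1 : PowerRel z fun i => e ((x * y⁻¹) i) :=
      ⟨_, hS, fun i => e (x i), fun i => e (y i), by ext i; simp, hz⟩
    exact hz.of_rel (schurRingPower_rel_iff.2 (h1.trans (powerRel_of_mulEquiv e _).symm))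
      (B.rel.refl _)
  refine ⟨f, ?_, hf1, ?_⟩
  · rintro _ ⟨a, rfl⟩
    obtain ⟨b, hb⟩ := hφ.exists_right a
    exact ⟨_, ⟨b, rfl⟩, fun x y => (hf x y).rel_iff hb⟩
  · rintro ⟨_, a, rfl⟩
    obtain ⟨b, hb⟩ := hφ.exists_right a
    have h1 : (φ ((schurRingPower G (m + 1)).basicElt ⟨_, a, rfl⟩) : MonoidAlgebra ℤ H) =
      setSum {y | B.rel y b} := congrArg Subtype.val hb
    rw [h1]
    congr 1
    ext y
    obtain ⟨x, rfl⟩ := f.surjective y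
    have h2 := hf x 1
    rw [hf1, inv_one, inv_one, mul_one, mul_one] at h2
    rw [f.injective.mem_set_image]
    exact (h2.rel_iff hb).symm

/-- If the algebraic isomorphisms of `𝔄_m(G)` are induced by isomorphisms, then `G` is identified
by the `3m`-dimensional Weisfeiler-Leman algorithm: a normalized isomorphism between `𝔄_m(G)` and
`𝔄_m(H)` acts coordinatewise, by an isomorphism of `G` and `H`. -/
theorem AlgIsosInduced.nonempty_mulEquiv (hm : 3 ≤ m) (hG : AlgIsosInduced G m) {H : Type u}
    [Group H] [Finite H] (hGH : WLEquivalent (3 * m) G H) : Nonempty (G ≃* H) := by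
  have hm0 : 0 < m := by omega
  obtain ⟨x₀, y₀, h₀⟩ := wlEquivalent_iff.1 hGH
  have hl : ∀ x : Fin m → G, ∃ y : Fin m → H, PowerRel x y := fun x => by
    obtain ⟨y, hy, -⟩ := (isWLBisim_retract hm0 (by omega)).exists_right
      (h₀.retract hm0 (Fin.castLE (by omega))) x
    exact ⟨y, _, isPowerBisim_retract hm0, hy⟩
  obtain ⟨φ, hφ, hcorr⟩ := SchurRing.exists_isAlgebraicIso (S := schurRingPower G m)
    (T := schurRingPower H m) isPowerBisim_powerRel.toIsSchurBisim hl fun x x' y y' h h' => by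
      rw [schurRingPower_rel_iff, schurRingPower_rel_iff]
      exact ⟨fun hx => h.symm.trans (hx.trans h'), fun hy => h.trans (hy.trans h'.symm)⟩
  obtain ⟨f, hiso, hf1, hf⟩ := hG _ _ φ hφ
  have key : ∀ x y, PowerRel (x * y⁻¹) (f x * (f y)⁻¹) := by
    intro x y
    obtain ⟨w, hw⟩ := hl (x * y⁻¹)
    obtain ⟨Y, hY, hXY⟩ := hiso _ ((schurRingPower G m).rel.mem_classes (x * y⁻¹))
    have h1 : f x * (f y)⁻¹ ∈ Y := (hXY x y).1 ((schurRingPower G m).rel.refl _)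
    have h2 : f (x * y⁻¹) ∈ Y := by
      have := (hXY (x * y⁻¹) 1).1 (by simp)
      rwa [hf1, inv_one, mul_one] at this
    have h3 : setSum {z | (schurRingPower H m).rel z w} =
        setSum (f '' {z | (schurRingPower G m).rel z (x * y⁻¹)}) :=
      (congrArg Subtype.val (hcorr _ _ hw)).symm.trans
        (hf ((schurRingPower G m).basicSet (x * y⁻¹)))
    have h4 : f (x * y⁻¹) ∈ {z | (schurRingPower H m).rel z w} := by
      rw [setSum_injective h3]
      exact ⟨_, (schurRingPower G m).rel.refl _, rfl⟩
    rw [mem_class_iff hY h2] at h1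
    exact hw.trans (schurRingPower_rel_iff.1 ((schurRingPower H m).rel.trans h1 h4)).symm
  have hcoord : ∀ x y i, x i = y i ↔ f x i = f y i := fun x y i => by
    have := (key x y).eq_one i
    rwa [Pi.mul_apply, Pi.mul_apply, Pi.inv_apply, Pi.inv_apply, mul_inv_eq_one,
      mul_inv_eq_one] at this
  have hpow : ∀ x, PowerRel x (f x) := fun x => by
    have := key x 1
    rwa [hf1, inv_one, inv_one, mul_one, mul_one] at this
  let a : Fin m := ⟨0, by omega⟩
  let b : Fin m := ⟨1, by omega⟩
  let c : Fin m := ⟨2, by omega⟩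
  have hab : a ≠ b := by simp [a, b]
  have hac : a ≠ c := by simp [a, c]
  have hbc : b ≠ c := by simp [b, c]
  let g : G → H := fun s => f (fun _ => s) a
  have hg : ∀ x i, f x i = g (x i) := fun x i =>
    ((hcoord x (fun _ => x i) i).1 rfl).trans ((hpow fun _ => x i).apply_eq_apply rfl)
  refine ⟨MulEquiv.ofBijective (MonoidHom.mk' g fun s t => ?_) ⟨fun s t hst => ?_, fun h => ?_⟩⟩
  · classical
    have h1 := (hpow fun i => if i = a then s else if i = b then t else s * t).mul_eq
      (i := a) (j := b) (k := c) hab hac (by simp [hab.symm, hac.symm, hbc.symm])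
    simp only [hg] at h1
    simpa [hab.symm, hac.symm, hbc.symm] using h1.symm
  · exact (hcoord (fun _ => s) (fun _ => t) a).2 hst
  · refine ⟨f.symm (fun _ => h) a, ?_⟩
    have h1 := hg (f.symm fun _ => h) a
    rw [f.apply_symm_apply] at h1
    exact h1.symm

/-- A tuple that lists all elements of a group determines the group by its atomic type. -/
theorem nonempty_mulEquiv_of_card_le (hG : Nat.card G ≤ m) {H : Type u} [Group H]
    [Finite H] (hGH : WLEquivalent m G H) : Nonempty (G ≃* H) := by
  obtain ⟨x₀, y₀, h₀⟩ := wlEquivalent_iff.1 hGH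
  obtain ⟨x, hx⟩ : ∃ x : Fin m → G, Function.Surjective x := by
    have e := Finite.equivFin G
    refine ⟨fun i => if h : (i : ℕ) < Nat.card G then e.symm ⟨i, h⟩ else 1, fun g => ?_⟩
    exact ⟨⟨e g, (e g).2.trans_le hG⟩, by simp⟩
  obtain ⟨y, hy, -⟩ := isWLBisim_wlRel.exists_right h₀ x
  obtain ⟨π, -⟩ := isWLBisim_wlRel.update _ _ hy
  choose s hs using hx
  refine ⟨MulEquiv.ofBijective (MonoidHom.mk' (fun g => y (s g)) fun g g' => ?_) ?_⟩
  · exact ((isWLBisim_wlRel.mul_iff _ _ hy _ _ _).1 (by rw [hs, hs, hs])).symm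
  · have hinj : Function.Injective fun g => y (s g) := fun g g' h => by
      have := (isWLBisim_wlRel.eq_iff _ _ hy _ _).2 h
      rwa [hs, hs] at this
    exact hinj.bijective_of_nat_card_le (Nat.card_congr π).ge

end Dimension
end WLSchur

theorem theorem1p3 (G : Type*) [Group G] [Finite G] :
    (∀ m : ℕ, 1 ≤ m →
      IsAtLeastAsFine
        (projClasses (show m ≤ 3 * m by omega) (WL (3 * m) G))
        (schurRingPower G m).basicSets ∧
      IsAtLeastAsFine
        (projClasses (show m ≤ m + 1 by omega) (schurRingPower G (m + 1)).rel)
        (WL m G).classes) ∧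
    ∃ s : ℕ,
      IsLeast {t : ℕ | 3 ≤ t ∧ ∀ m : ℕ, t ≤ m → AlgIsosInduced G m} s ∧
      wlDim G ≤ 3 * s ∧
      s ≤ wlDim G + 1 := by
  refine ⟨fun m hm => ⟨projClasses_WL_isAtLeastAsFine hm _,
    projClasses_schurRingPower_isAtLeastAsFine _⟩, ?_⟩
  have hdim := Nat.sInf_mem (s := {m | 2 ≤ m ∧ ∀ (H : Type _) [Group H] [Finite H],
      WLEquivalent m G H → Nonempty (G ≃* H)})
    ⟨max 2 (Nat.card G), le_max_left _ _, fun H _ _ h =>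
      nonempty_mulEquiv_of_card_le (le_max_right _ _) h⟩
  change 2 ≤ wlDim G ∧ ∀ (H : Type _) [Group H] [Finite H],
      WLEquivalent (wlDim G) G H → Nonempty (G ≃* H) at hdim
  obtain ⟨hdim2, hdim⟩ := hdim
  have hmem : wlDim G + 1 ∈ {t : ℕ | 3 ≤ t ∧ ∀ m : ℕ, t ≤ m → AlgIsosInduced G m} := by
    refine ⟨by omega, fun m hm => ?_⟩
    obtain ⟨n, rfl⟩ : ∃ n, m = n + 1 := ⟨m - 1, by omega⟩
    exact algIsosInduced_succ (by omega) fun K _ _ hK =>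
      hdim K (hK.of_le (by omega) (by omega))
  have hs := Nat.sInf_mem ⟨_, hmem⟩
  refine ⟨_, ⟨hs, fun t ht => Nat.sInf_le ht⟩, Nat.sInf_le ⟨?_, fun H _ _ hH => ?_⟩,
    Nat.sInf_le hmem⟩
  · have := hs.1
    omega
  · exact (hs.2 _ le_rfl).nonempty_mulEquiv hs.1 hH
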